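/- **Corollary 3.4.** Let $G=(U,V)$ be a finite simple bipartite graph with $|U|=|V|=n$, drawn in the plane without crossings (vertices are distinct points, edges are simple arcs that meet only in common end points), and let every edge $e$ of $G$ carry a weight $\omega_e$ in a commutative ring (for example a real number or an indeterminate). For a subgraph $H$ of $G$ let $M(H)=\sum_P\prod_{e\in P}\omega_e$, where $P$ runs over all perfect matchings of $H$. For sets $X$ of vertices and $S$ of edges, $G-X$ is obtained by deleting the vertices in $X$ together with all incident edges, and $G-X-S$ by then deleting the edges in $S$ that are still present. Let $2\le k\le n$, and let $e_1=a_1b_1,\ \dots,\ e_k=a_kb_k$ be pairwise disjoint edges of $G$ with $a_i\in U$ and $b_i\in V$ for all $i$, all lying in the boundary of one face $f$ of $G$ (a connected component of the complement of the drawing). Suppose that $a_1,b_1,a_2,b_2,\dots,a_k,b_k$ appear in this cyclic order (clockwise or counterclockwise) on $f$; that is, from some point of $f$ one can draw simple arcs to these vertices that run inside $f$ up to their end points, meet pairwise only in the starting point, and leave it as straight segments in this cyclic order. Write $[k]=\{1,\dots,k\}$ and $E_I=\{e_t : t\in I\}$ for $I\subseteq[k]$. Then for every $j\in[k]$, $$M(G)\,M(G-E_{[k]})=M(G-e_j)\,M(G-E_{[k]\setminus\{j\}})+\sum_{\substack{1\le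 i\le k\\ i\ne j}}\omega_{e_i}\,\omega_{e_j}\,M(G-a_i-b_j)\,M(G-a_j-b_i-E_{[k]\setminus\{i,j\}}).$$ -/

import Mathlib

open scoped Real unitInterval

/-- A set of edges `P` of the graph `H` is a perfect matching of `H` if every vertex of `H` lies on
exactly one edge of `P`. The graph `H` is given as a subgraph of an ambient graph `G`. -/
def IsPerfectMatchingOf {W : Type*} {G : SimpleGraph W} (H : G.Subgraph)
    (P : Finset (Sym2 W)) : Prop :=
  (∀ e ∈ P, e ∈ H.edgeSet) ∧ ∀ v ∈ H.verts, ∃! e : Sym2 W, e ∈ P ∧ v ∈ e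

open Classical in
/-- `M(H)`: the sum over all perfect matchings of `H` of the product of the weights of their
edges. -/
noncomputable def matchingSum {W R : Type*} [Fintype W] [CommRing R] {G : SimpleGraph W}
    (ω : Sym2 W → R) (H : G.Subgraph) : R :=
  ∑ P : Finset (Sym2 W) with IsPerfectMatchingOf H P, ∏ e ∈ P, ω e

/-- A drawing of `G` in the plane `ℂ` without crossings: the vertices are distinct points, every
edge is a simple arc joining its end points (given once for each of the two directions in which the
edge can be traversed), an arc contains no vertex besides its end points, and two different edges
meet only in common end points. -/
structure PlaneDrawing {W : Type*} (G : SimpleGraph W) where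
  pos : W → ℂ
  pos_injective : Function.Injective pos
  arc : (d : G.Dart) → Path (pos d.fst) (pos d.snd)
  arc_injective : ∀ d, Function.Injective (arc d)
  arc_symm : ∀ d, arc d.symm = (arc d).symm
  pos_mem_arc : ∀ d v, pos v ∈ Set.range (arc d) → v ∈ d.edge
  arc_inter_arc : ∀ d d', d.edge ≠ d'.edge → ∀ z ∈ Set.range (arc d) ∩ Set.range (arc d'),
    ∃ v, v ∈ d.edge ∧ v ∈ d'.edge ∧ pos v = z

namespace PlaneDrawing

variable {W : Type*} {G : SimpleGraph W} (D : PlaneDrawing G)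

/-- The point set of the drawing: all vertices and all points of edges. -/
def carrier : Set ℂ :=
  Set.range D.pos ∪ ⋃ d, Set.range (D.arc d)

/-- A face is a connected component of the complement of the drawing. -/
def IsFace (f : Set ℂ) : Prop :=
  ∃ z ∈ D.carrierᶜ, f = connectedComponentIn D.carrierᶜ z

/-- The edge underlying `d` lies in the boundary of the face `f`. -/
def EdgeOnBoundary (f : Set ℂ) (d : G.Dart) : Prop :=
  Set.range (D.arc d) ⊆ frontier f

/-- The vertices `p i`, taken in the order of the index set `ι`, appear in this cyclic order
(clockwise or counterclockwise) on the face `f`: from some point `c` of `f` one can draw simple arcs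
to them which run inside `f` up to their last point, pairwise meet only in `c`, and leave `c` (as
straight segments, in the directions `exp (θ i * I)`) in this cyclic order. For a face with a
connected boundary this is the cyclic order along its boundary walk; the formulation also makes
sense when the boundary is disconnected, or passes several times through a vertex. -/
def InCyclicOrder {ι : Type*} [LinearOrder ι] (f : Set ℂ) (p : ι → W) : Prop :=
  ∃ (c : ℂ) (γ : (i : ι) → Path c (D.pos (p i))) (θ : ι → ℝ) (δ : ℝ),
    c ∈ f ∧
    (∀ i, Function.Injective (γ i)) ∧
    (∀ i (t : I), t ≠ 1 → γ i t ∈ f) ∧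
    (∀ i j, i ≠ j → ∀ s t : I, γ i s = γ j t → s = 0 ∧ t = 0) ∧
    0 < δ ∧
    (∀ i (t : I), (t : ℝ) ≤ δ → γ i t = c + (t : ℝ) * Complex.exp (θ i * Complex.I)) ∧
    (StrictMono θ ∨ StrictAnti θ) ∧
    ∀ i j, θ i - θ j < 2 * π

end PlaneDrawing

/-- The sequence `a₁, b₁, a₂, b₂, …, aₖ, bₖ`, indexed by the lexicographically ordered pairs. -/
def alternating {W : Type*} {k : ℕ} (a b : Fin k → W) : Fin k ×ₗ Fin 2 → W :=
  fun x => if (ofLex x).2 = 0 then a (ofLex x).1 else b (ofLex x).1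


/-!
Planarity enters only through the fact that no two disjoint walks join `a i` to `a j` and `b i` to
`b j`. Closed up inside the face, such walks would give two closed curves `J` and `K` that cross at
the centre of the face and are disjoint elsewhere. Then `J s - K t` would have a continuous
logarithm on the unit square without its corners; but its variations around the four corners, which
are given by the directions at the centre, do not sum to the value that closedness forces.

The identity itself is a bijection between pairs `(P, Q)` of perfect matchings. The superposition of
`P` and `Q` consists of the cycles of the permutation `P⁻¹ Q`. Two operations preserve the weight of
a pair: exchanging `P` and `Q` on the cycle through `a j`, and swapping the values of `P` at `a i`
and `a j`, by which the edges `a i b i` and `a j b j` turn into the virtual edges `a i b j` and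
`a j b i`. The swap multiplies `P⁻¹ Q` by a transposition, so it merges or splits cycles. Since a
common cycle of `a i` and `a j` would contain two disjoint walks as above, these vertices lie on
different cycles whenever this is needed, and the two operations can be undone.
-/


open Filter Topology Set

lemma sub_eq_sub_of_exp_eq {X : Type*} [TopologicalSpace X] {s : Set X} (hs : IsPreconnected s)
    {f g : X → ℂ} (hf : ContinuousOn f s) (hg : ContinuousOn g s)
    (hfg : ∀ x ∈ s, Complex.exp (f x) = Complex.exp (g x)) {x y : X} (hx : x ∈ s) (hy : y ∈ s) :
    f x - g x = f y - g y := by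
  have hexp : ∀ x ∈ s, Complex.exp (f x - g x) = 1 := fun x hx => by
    rw [Complex.exp_sub, hfg x hx, div_self (Complex.exp_ne_zero _)]
  exact Complex.isCoveringMap_exp.constOn_of_comp hs (hf.sub hg)
    (fun x hx y hy => Subtype.ext ((hexp x hx).trans (hexp y hy).symm)) hx hy

lemma sub_eq_log_div_of_exp_eq_segment {g : ℝ → ℂ} (hg : ContinuousOn g (Icc 0 1)) {z w : ℂ}
    (hz : z ≠ 0) (hwz : w / z ∈ Complex.slitPlane)
    (hexp : ∀ τ ∈ Icc (0 : ℝ) 1, Complex.exp (g τ) = (1 - τ) * z + τ * w) :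
    g 1 - g 0 = Complex.log (w / z) := by
  let q : ℝ → ℂ := fun τ => (1 - τ) + τ * (w / z)
  have hq : ∀ τ ∈ Icc (0 : ℝ) 1, q τ ∈ Complex.slitPlane := fun τ hτ => by
    simpa [q] using Complex.starConvex_one_slitPlane hwz (sub_nonneg.2 hτ.2) hτ.1
      (sub_add_cancel 1 τ)
  have hlog : ContinuousOn (fun τ => Complex.log (q τ) + Complex.log z) (Icc 0 1) :=
    (ContinuousOn.clog (by fun_prop) hq).add continuousOn_const
  have hg_log := sub_eq_sub_of_exp_eq isPreconnected_Icc hg hlog (fun τ hτ => by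
    rw [hexp τ hτ, Complex.exp_add, Complex.exp_log (Complex.slitPlane_ne_zero (hq τ hτ)),
      Complex.exp_log hz]
    simp only [q]
    field_simp) (right_mem_Icc.2 zero_le_one) (left_mem_Icc.2 (zero_le_one' ℝ))
  have hq1 : q 1 = w / z := by simp [q]
  have hq0 : q 0 = 1 := by simp [q]
  rw [hq1, hq0, Complex.log_one] at hg_log
  linear_combination hg_log

lemma arg_neg_mul_exp_mul_I {r φ : ℝ} (hr : 0 < r) (hφ : φ ∈ Ioo 0 (2 * π)) :
    (-(r * Complex.exp (φ * Complex.I))).arg = φ - π := by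
  have hneg : -(r * Complex.exp (φ * Complex.I)) =
      r * Complex.exp ((φ - π : ℝ) * Complex.I) := by
    push_cast
    rw [sub_mul, Complex.exp_sub, Complex.exp_pi_mul_I]
    ring
  rw [hneg, Complex.arg_real_mul _ hr, Complex.arg_exp_mul_I, toIocMod_eq_self Real.two_pi_pos]
  constructor <;> linarith [hφ.1, hφ.2]

/-- The curve `γ` starts in `c` with a straight segment in the direction `exp (θ * I)`. -/
def StartsStraight (γ : ℝ → ℂ) (c : ℂ) (θ : ℝ) : Prop :=
  ∃ r : ℝ, 0 < r ∧ ∀ᶠ t in 𝓝[≥] (0 : ℝ), γ t = c + t * (r * Complex.exp (θ * Complex.I))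

namespace StartsStraight

variable {γ : ℝ → ℂ} {c : ℂ} {θ : ℝ}

lemma apply_zero (h : StartsStraight γ c θ) : γ 0 = c := by
  obtain ⟨r, -, hγ⟩ := h
  simpa using hγ.self_of_nhdsWithin self_mem_Ici

lemma add_two_pi (h : StartsStraight γ c θ) : StartsStraight γ c (θ + 2 * π) := by
  obtain ⟨r, hr, hγ⟩ := h
  refine ⟨r, hr, ?_⟩
  push_cast
  rwa [add_mul, Complex.exp_periodic]

lemma exists_Icc (h : StartsStraight γ c θ) : ∃ r : ℝ, 0 < r ∧ ∃ δ : ℝ, 0 < δ ∧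
    ∀ t ∈ Icc 0 δ, γ t = c + t * (r * Complex.exp (θ * Complex.I)) := by
  obtain ⟨r, hr, hγ⟩ := h
  obtain ⟨δ, hδ, hsub⟩ := mem_nhdsGE_iff_exists_Icc_subset.1 hγ
  exact ⟨r, hr, δ, hδ, hsub⟩

lemma trans {x y : ℂ} {γ : Path c x} (h : StartsStraight γ.extend c θ) (P : Path x y) :
    StartsStraight (γ.trans P).extend c θ := by
  obtain ⟨r, hr, hγ⟩ := h
  have hdouble : Tendsto (fun t : ℝ => 2 * t) (𝓝[≥] 0) (𝓝[≥] 0) :=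
    tendsto_nhdsWithin_iff.2 ⟨(Continuous.tendsto' (by fun_prop) 0 0 (mul_zero 2)).mono_left
      nhdsWithin_le_nhds, eventually_mem_nhdsWithin.mono fun t ht =>
        mem_Ici.2 (mul_nonneg zero_le_two ht)⟩
  refine ⟨2 * r, by positivity, ?_⟩
  filter_upwards [hdouble.eventually hγ,
    eventually_nhdsWithin_of_eventually_nhds (eventually_le_nhds one_half_pos)] with t ht ht'
  rw [Path.extend_trans_of_le_half _ _ ht', ht]
  push_cast
  ring

end StartsStraight

/-- The plane without the four closed quadrants that touch the unit square in a corner. -/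
def plusShape : Set (ℝ × ℝ) := {x | x.1 ∈ Ioo (0 : ℝ) 1 ∨ x.2 ∈ Ioo (0 : ℝ) 1}

lemma isOpen_plusShape : IsOpen plusShape :=
  (isOpen_Ioo.preimage continuous_fst).union (isOpen_Ioo.preimage continuous_snd)

lemma isSimplyConnected_plusShape : IsSimplyConnected plusShape := by
  have hI : StarConvex ℝ (1 / 2 : ℝ) (Ioo (0 : ℝ) 1) :=
    (convex_Ioo 0 1).starConvex (by norm_num)
  have hstar : StarConvex ℝ ((1 / 2, 1 / 2) : ℝ × ℝ) plusShape := fun y hy a b ha hb hab =>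
    hy.imp (fun hy => hI hy ha hb hab) (fun hy => hI hy ha hb hab)
  have := hstar.contractibleSpace ⟨(1 / 2, 1 / 2), Or.inl (by norm_num)⟩
  exact inferInstanceAs (SimplyConnectedSpace plusShape)

/-- A continuous logarithm of the difference of the plane curves `J` and `K`. -/
structure IsLogDiff (f : ℝ → ℝ → ℂ) (J K : ℝ → ℂ) : Prop where
  continuousOn : ContinuousOn (fun x : ℝ × ℝ => f x.1 x.2) plusShape
  exp_eq : ∀ {s t}, (s, t) ∈ plusShape → Complex.exp (f s t) = J s - K t

lemma exists_isLogDiff {J K : ℝ → ℂ} (hJ : Continuous J) (hK : Continuous K)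
    (hJK : ∀ x ∈ plusShape, J x.1 ≠ K x.2) : ∃ f, IsLogDiff f J K := by
  obtain ⟨f, hf, hexp⟩ := Complex.exists_continuousOn_eqOn_exp_comp isSimplyConnected_plusShape
    isOpen_plusShape (g := fun x => J x.1 - K x.2) (by fun_prop)
    (by rintro ⟨x, hx, h⟩; exact hJK x hx (sub_eq_zero.1 h))
  exact ⟨fun s t => f (s, t), hf, fun h => hexp h⟩

namespace IsLogDiff

variable {f : ℝ → ℝ → ℂ} {J K : ℝ → ℂ}

lemma reflect_left (h : IsLogDiff f J K) :
    IsLogDiff (fun s t => f (1 - s) t) (fun s => J (1 - s)) K := by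
  have hmaps : MapsTo (fun x : ℝ × ℝ => (1 - x.1, x.2)) plusShape plusShape := fun x =>
    Or.imp_left Ioo.one_sub_mem
  exact ⟨h.continuousOn.comp (by fun_prop) hmaps, fun hst => h.exp_eq (hmaps hst)⟩

lemma reflect_right (h : IsLogDiff f J K) :
    IsLogDiff (fun s t => f s (1 - t)) J (fun t => K (1 - t)) := by
  have hmaps : MapsTo (fun x : ℝ × ℝ => (x.1, 1 - x.2)) plusShape plusShape := fun x =>
    Or.imp_right Ioo.one_sub_mem
  exact ⟨h.continuousOn.comp (by fun_prop) hmaps, fun hst => h.exp_eq (hmaps hst)⟩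

lemma sub_eq_sub_of_left_eq (h : IsLogDiff f J K) {s s' : ℝ} (hJ : J s = J s') {t t' : ℝ}
    (ht : t ∈ Ioo 0 1) (ht' : t' ∈ Ioo 0 1) : f s t - f s' t = f s t' - f s' t' := by
  have hf : ∀ s, ContinuousOn (f s) (Ioo 0 1) := fun s =>
    h.continuousOn.comp (f := fun t => (s, t)) (by fun_prop) fun t ht => Or.inr ht
  exact sub_eq_sub_of_exp_eq isPreconnected_Ioo (hf s) (hf s')
    (fun t ht => by rw [h.exp_eq (Or.inr ht), h.exp_eq (Or.inr ht), hJ]) ht ht'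

lemma sub_eq_sub_of_right_eq (h : IsLogDiff f J K) {t t' : ℝ} (hK : K t = K t') {s s' : ℝ}
    (hs : s ∈ Ioo 0 1) (hs' : s' ∈ Ioo 0 1) : f s t - f s t' = f s' t - f s' t' := by
  have hf : ∀ t, ContinuousOn (fun s => f s t) (Ioo 0 1) := fun t =>
    h.continuousOn.comp (f := fun s => (s, t)) (by fun_prop) fun s hs => Or.inl hs
  exact sub_eq_sub_of_exp_eq isPreconnected_Ioo (hf t) (hf t')
    (fun s hs => by rw [h.exp_eq (Or.inl hs), h.exp_eq (Or.inl hs), hK]) hs hs'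

/-- On the segment from `(0, ε)` to `(ε, 0)` the difference `J s - K t` runs straight from
`-ε r' exp (θ' I)` to `ε r exp (θ I)`. -/
lemma eventually_im_corner (h : IsLogDiff f J K) {c : ℂ} {θ θ' : ℝ} (hJ : StartsStraight J c θ)
    (hK : StartsStraight K c θ') (hθ : θ - θ' ∈ Ioo 0 (2 * π)) :
    ∀ᶠ ε in 𝓝[>] 0, (f ε 0 - f 0 ε).im = θ - θ' - π := by
  obtain ⟨r, hr, δ, hδ, hJ⟩ := hJ.exists_Icc
  obtain ⟨r', hr', δ', hδ', hK⟩ := hK.exists_Icc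
  filter_upwards [Ioo_mem_nhdsGT hδ, Ioo_mem_nhdsGT hδ', Ioo_mem_nhdsGT one_pos] with ε hε hε' hε1
  have hmaps : MapsTo (fun τ => (ε * τ, ε * (1 - τ))) (Icc 0 1) plusShape := by
    intro τ hτ
    rcases hτ.1.eq_or_lt with rfl | hτ0
    · exact Or.inr (by simpa using hε1)
    · exact Or.inl ⟨mul_pos hε.1 hτ0, by nlinarith [hτ.2, hε1.1, hε1.2]⟩
  have hexp : ∀ τ ∈ Icc (0 : ℝ) 1, Complex.exp (f (ε * τ) (ε * (1 - τ))) =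
      (1 - τ) * (-(ε * (r' * Complex.exp (θ' * Complex.I)))) +
        τ * (ε * (r * Complex.exp (θ * Complex.I))) := fun τ hτ => by
    rw [h.exp_eq (hmaps hτ), hJ _ ⟨by nlinarith [hτ.1, hε.1], by nlinarith [hτ.2, hε.1, hε.2]⟩,
      hK _ ⟨by nlinarith [hτ.2, hε.1], by nlinarith [hτ.1, hε.1, hε'.2]⟩]
    push_cast
    ring
  have hε0 : (ε : ℂ) ≠ 0 := Complex.ofReal_ne_zero.2 hε.1.ne'
  have hr'0 : (r' : ℂ) ≠ 0 := Complex.ofReal_ne_zero.2 hr'.ne'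
  have hdiv : ε * (r * Complex.exp (θ * Complex.I)) / -(ε * (r' * Complex.exp (θ' * Complex.I))) =
      -((r / r' : ℝ) * Complex.exp ((θ - θ' : ℝ) * Complex.I)) := by
    push_cast
    rw [sub_mul, Complex.exp_sub]
    field_simp
  have harg := arg_neg_mul_exp_mul_I (div_pos hr hr') hθ
  have hlog := sub_eq_log_div_of_exp_eq_segment (h.continuousOn.comp (by fun_prop) hmaps)
    (neg_ne_zero.2 (mul_ne_zero hε0 (mul_ne_zero hr'0 (Complex.exp_ne_zero _))))
    (by
      rw [hdiv, Complex.mem_slitPlane_iff_arg, harg]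
      exact ⟨by linarith [hθ.2], by simp [hr.ne', hr'0]⟩) hexp
  rw [hdiv] at hlog
  simpa only [Function.comp_apply, mul_one, mul_zero, sub_self, sub_zero, Complex.log_im, harg]
    using congrArg Complex.im hlog

end IsLogDiff

/-- Otherwise `J s - K t` has a continuous logarithm, whose variations around the four corners of
the unit square do not fit together: as both curves are closed, opposite sides of the square
cancel. -/
theorem exists_eq_of_crossing {J K : ℝ → ℂ} (hJ : Continuous J) (hK : Continuous K) {c : ℂ}
    {θ₁ θ₂ θ₃ θ₄ : ℝ} (h12 : θ₁ < θ₂) (h23 : θ₂ < θ₃) (h34 : θ₃ < θ₄) (h41 : θ₄ - θ₁ < 2 * π)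
    (hJ0 : StartsStraight J c θ₁) (hK0 : StartsStraight K c θ₂)
    (hJ1 : StartsStraight (fun s => J (1 - s)) c θ₃)
    (hK1 : StartsStraight (fun t => K (1 - t)) c θ₄) : ∃ x ∈ plusShape, J x.1 = K x.2 := by
  by_contra! hne
  obtain ⟨f, hf⟩ := exists_isLogDiff hJ hK hne
  have hJ01 : J 1 = J 0 := by simpa [hJ0.apply_zero] using hJ1.apply_zero
  have hK01 : K 1 = K 0 := by simpa [hK0.apply_zero] using hK1.apply_zero
  have corner₁ := hf.eventually_im_corner hJ0.add_two_pi hK0 ⟨by linarith, by linarith⟩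
  have corner₂ := hf.reflect_left.eventually_im_corner hJ1 hK0 ⟨by linarith, by linarith⟩
  have corner₃ := hf.reflect_left.reflect_right.eventually_im_corner hJ1.add_two_pi hK1
    ⟨by linarith, by linarith⟩
  have corner₄ := hf.reflect_right.eventually_im_corner hJ0.add_two_pi hK1
    ⟨by linarith, by linarith⟩
  obtain ⟨ε, hε, h₁, h₂, h₃, h₄⟩ := ((eventually_mem_set.2 (Ioo_mem_nhdsGT one_pos)).and
    (corner₁.and (corner₂.and (corner₃.and corner₄)))).exists
  have hε' := Ioo.one_sub_mem hε
  have hvert := congrArg Complex.im (hf.sub_eq_sub_of_left_eq hJ01 hε hε')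
  have hhor := congrArg Complex.im (hf.sub_eq_sub_of_right_eq hK01 hε hε')
  simp only [Complex.sub_im, sub_zero] at h₁ h₂ h₃ h₄ hvert hhor
  linarith [Real.pi_pos]

/-- The loop that runs along `γ`, then along `P`, and then back along `γ'`. -/
noncomputable def arcLoop {X : Type*} [TopologicalSpace X] {c x y : X} (γ : Path c x)
    (P : Path x y) (γ' : Path c y) : Path c c :=
  (γ.trans P).trans γ'.symm

section arcLoop

variable {X : Type*} [TopologicalSpace X] {c x y : X} (γ : Path c x) (P : Path x y) (γ' : Path c y)

lemma range_arcLoop : range (arcLoop γ P γ') = range γ ∪ range P ∪ range γ' := by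
  simp only [arcLoop, Path.trans_range, Path.symm_range]

lemma extend_mem_image_compl_zero {t : ℝ} (ht : 0 < t) : γ.extend t ∈ γ '' {0}ᶜ := by
  refine ⟨projIcc 0 1 zero_le_one t, fun h => ?_, rfl⟩
  simpa [projIcc_eq_left] using ht.not_ge ((projIcc_eq_left zero_lt_one).1 h)

lemma arcLoop_extend_mem {s : ℝ} (hs : s ∈ Ioo 0 1) :
    (arcLoop γ P γ').extend s ∈ γ '' {0}ᶜ ∪ range P ∪ γ' '' {0}ᶜ := by
  rcases le_total s (1 / 2) with h | h
  · rw [arcLoop, Path.extend_trans_of_le_half _ _ h]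
    rcases le_total (2 * s) (1 / 2) with h' | h'
    · rw [Path.extend_trans_of_le_half _ _ h']
      exact Or.inl (Or.inl (extend_mem_image_compl_zero γ (by linarith [hs.1])))
    · rw [Path.extend_trans_of_half_le _ _ h', ← P.extend_range]
      exact Or.inl (Or.inr (mem_range_self _))
  · rw [arcLoop, Path.extend_trans_of_half_le _ _ h, Path.extend_symm_apply]
    exact Or.inr (extend_mem_image_compl_zero γ' (by linarith [hs.2]))

end arcLoop

lemma StartsStraight.arcLoop {c x y : ℂ} {γ : Path c x} {θ : ℝ}
    (h : StartsStraight γ.extend c θ) (P : Path x y) (γ' : Path c y) :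
    StartsStraight (arcLoop γ P γ').extend c θ :=
  (h.trans P).trans γ'.symm

lemma StartsStraight.arcLoop_reverse {c x y : ℂ} {γ' : Path c y} {θ : ℝ}
    (h : StartsStraight γ'.extend c θ) (γ : Path c x) (P : Path x y) :
    StartsStraight (fun s => (_root_.arcLoop γ P γ').extend (1 - s)) c θ := by
  rw [← Path.extend_symm, _root_.arcLoop, Path.trans_symm, Path.symm_symm]
  exact h.trans _

section Arcs

variable {ι : Type*} {c : ℂ} {p : ι → ℂ}

/-- The arcs `γ i` from `c` to `p i` meet pairwise only in `c`, where they start in the directions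
`θ i`, all less than a full turn apart. -/
structure IsStraightStar (γ : ∀ i, Path c (p i)) (θ : ι → ℝ) : Prop where
  eq_zero : ∀ {i j}, i ≠ j → ∀ {s t : I}, γ i s = γ j t → s = 0 ∧ t = 0
  startsStraight : ∀ i, StartsStraight (γ i).extend c (θ i)
  sub_lt : ∀ i j, θ i - θ j < 2 * π

namespace IsStraightStar

variable {γ : ∀ i, Path c (p i)} {θ : ι → ℝ}

lemma disjoint_image_compl_zero (h : IsStraightStar γ θ) {i j : ι} (hij : i ≠ j) :
    Disjoint (γ i '' {0}ᶜ) (range (γ j)) := by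
  rw [Set.disjoint_left]
  rintro _ ⟨s, hs, rfl⟩ ⟨t, ht⟩
  exact hs (h.eq_zero hij ht.symm).1

lemma arcLoop_extend_ne (h : IsStraightStar γ θ) {i j k l : ι} (hij : i ≠ j) (hil : i ≠ l)
    (hkj : k ≠ j) (hkl : k ≠ l) {P : Path (p i) (p k)} {Q : Path (p j) (p l)}
    (hPQ : Disjoint (range P) (range Q)) (hPj : Disjoint (range P) (range (γ j)))
    (hPl : Disjoint (range P) (range (γ l))) (hQi : Disjoint (range Q) (range (γ i)))
    (hQk : Disjoint (range Q) (range (γ k))) {s : ℝ} (hs : s ∈ Ioo 0 1) (t : ℝ) :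
    (arcLoop (γ i) P (γ k)).extend s ≠ (arcLoop (γ j) Q (γ l)).extend t := by
  have hdisj : Disjoint (γ i '' {0}ᶜ ∪ range P ∪ γ k '' {0}ᶜ)
      (range (γ j) ∪ range Q ∪ range (γ l)) := by
    simp only [disjoint_union_left, disjoint_union_right]
    exact ⟨⟨⟨⟨h.disjoint_image_compl_zero hij, hPj⟩, h.disjoint_image_compl_zero hkj⟩,
      ⟨hQi.symm.mono_left (image_subset_range _ _), hPQ⟩,
      hQk.symm.mono_left (image_subset_range _ _)⟩,
      ⟨h.disjoint_image_compl_zero hil, hPl⟩, h.disjoint_image_compl_zero hkl⟩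
  refine hdisj.ne_of_mem (arcLoop_extend_mem _ _ _ hs) ?_
  rw [← range_arcLoop, ← Path.extend_range]
  exact mem_range_self t

theorem not_disjoint_of_interlaced (h : IsStraightStar γ θ) {i j k l : ι} (hij : θ i < θ j)
    (hjk : θ j < θ k) (hkl : θ k < θ l) {P : Path (p i) (p k)} {Q : Path (p j) (p l)}
    (hPj : Disjoint (range P) (range (γ j))) (hPl : Disjoint (range P) (range (γ l)))
    (hQi : Disjoint (range Q) (range (γ i))) (hQk : Disjoint (range Q) (range (γ k))) :
    ¬ Disjoint (range P) (range Q) := by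
  intro hPQ
  have hne : ∀ {x y}, θ x < θ y → x ≠ y := fun hlt heq => hlt.ne (congrArg θ heq)
  have hij' := hne hij
  have hil' := hne (hij.trans (hjk.trans hkl))
  have hjk' := hne hjk
  have hkl' := hne hkl
  obtain ⟨⟨s, t⟩, hst, heq⟩ := exists_eq_of_crossing (Path.continuous_extend _)
    (Path.continuous_extend _) hij hjk hkl (h.sub_lt l i) ((h.startsStraight i).arcLoop P (γ k))
    ((h.startsStraight j).arcLoop Q (γ l)) ((h.startsStraight k).arcLoop_reverse (γ i) P)
    ((h.startsStraight l).arcLoop_reverse (γ j) Q)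
  rcases hst with hs | ht
  · exact h.arcLoop_extend_ne hij' hil' hjk'.symm hkl' hPQ hPj hPl hQi hQk hs t heq
  · exact h.arcLoop_extend_ne hij'.symm hjk' hil'.symm hkl'.symm hPQ.symm hQi hQk hPj hPl ht s
      heq.symm

end IsStraightStar

end Arcs

namespace PlaneDrawing

variable {W : Type*} {G : SimpleGraph W} (D : PlaneDrawing G)

/-- The part of the drawing that belongs to the subgraph induced on `S`. -/
def part (S : Set W) : Set ℂ :=
  D.pos '' S ∪ ⋃ (d : G.Dart) (_ : ∀ v ∈ d.edge, v ∈ S), range (D.arc d)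

lemma part_subset_carrier (S : Set W) : D.part S ⊆ D.carrier :=
  union_subset_union (image_subset_range _ _)
    (iUnion_mono fun _ => iUnion_subset fun _ => subset_rfl)

lemma pos_mem_part {S : Set W} {v : W} : D.pos v ∈ D.part S ↔ v ∈ S := by
  refine ⟨?_, fun h => Or.inl (mem_image_of_mem _ h)⟩
  rintro (⟨w, hw, h⟩ | h)
  · rwa [← D.pos_injective h]
  · obtain ⟨d, hd, h⟩ := mem_iUnion₂.1 h
    exact hd v (D.pos_mem_arc d v h)

lemma disjoint_part {S T : Set W} (h : Disjoint S T) : Disjoint (D.part S) (D.part T) := by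
  rw [Set.disjoint_left] at h ⊢
  rintro z (⟨v, hv, rfl⟩ | hz) hz'
  · exact h hv (D.pos_mem_part.1 hz')
  · rcases hz' with ⟨v, hv, rfl⟩ | hz'
    · exact h (D.pos_mem_part.1 (Or.inr hz)) hv
    · obtain ⟨d, hd, hz⟩ := mem_iUnion₂.1 hz
      obtain ⟨d', hd', hz'⟩ := mem_iUnion₂.1 hz'
      obtain ⟨v, hv, hv'⟩ : ∃ v, v ∈ d.edge ∧ v ∈ d'.edge := by
        by_cases he : d.edge = d'.edge
        · exact ⟨d.fst, Sym2.mem_mk_left _ _, he ▸ Sym2.mem_mk_left _ _⟩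
        · obtain ⟨v, hv, hv', -⟩ := D.arc_inter_arc d d' he z ⟨hz, hz'⟩
          exact ⟨v, hv, hv'⟩
      exact h (hd v hv) (hd' v hv')

lemma joinedIn_part {S : Set W} {x y : W} (p : G.Walk x y) (hp : ∀ v ∈ p.support, v ∈ S) :
    JoinedIn (D.part S) (D.pos x) (D.pos y) := by
  induction p with
  | nil => exact JoinedIn.refl (D.pos_mem_part.2 (hp _ (by simp)))
  | @cons u v w h p ih =>
    have huv : ∀ x ∈ s(u, v), x ∈ S := fun x hx => hp x (by
      rcases Sym2.mem_iff.1 hx with rfl | rfl <;> simp)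
    exact JoinedIn.trans
      ⟨D.arc ⟨(u, v), h⟩, fun t => Or.inr (mem_iUnion₂.2 ⟨⟨(u, v), h⟩, huv, mem_range_self t⟩)⟩
      (ih fun x hx => hp x (by simp [hx]))

lemma IsFace.disjoint_carrier {D : PlaneDrawing G} {f : Set ℂ} (hf : D.IsFace f) :
    Disjoint f D.carrier := by
  obtain ⟨z, -, rfl⟩ := hf
  exact disjoint_left.2 (connectedComponentIn_subset _ _)

lemma disjoint_part_range_of_inside {f : Set ℂ} (hf : D.IsFace f) {S : Set W} {c : ℂ} {v : W}
    (hv : v ∉ S) {γ : Path c (D.pos v)} (hγ : ∀ t : I, t ≠ 1 → γ t ∈ f) :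
    Disjoint (D.part S) (range γ) := by
  rw [disjoint_right]
  rintro _ ⟨t, rfl⟩ ht
  by_cases h1 : t = 1
  · rw [h1, γ.target] at ht
    exact hv (D.pos_mem_part.1 ht)
  · exact disjoint_left.1 hf.disjoint_carrier (hγ t h1) (D.part_subset_carrier S ht)

lemma not_disjoint_support_of_isStraightStar {ι : Type*} {f : Set ℂ} (hf : D.IsFace f) {p : ι → W}
    {c : ℂ} {γ : ∀ i, Path c (D.pos (p i))} {θ : ι → ℝ} (hstar : IsStraightStar γ θ)
    (hγ : ∀ i (t : I), t ≠ 1 → γ i t ∈ f) {i j k l : ι} (hij : θ i < θ j) (hjk : θ j < θ k)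
    (hkl : θ k < θ l) (P : G.Walk (p i) (p k)) (Q : G.Walk (p j) (p l)) :
    ¬ P.support.Disjoint Q.support := by
  intro hPQ
  have hpart := D.disjoint_part (Set.disjoint_left.2 fun v hv hv' => hPQ hv hv' :
    Disjoint {v | v ∈ P.support} {v | v ∈ Q.support})
  have hP_arc : ∀ {x}, p x ∈ Q.support → Disjoint (D.part {v | v ∈ P.support}) (range (γ x)) :=
    fun hx => D.disjoint_part_range_of_inside hf (fun hx' => hPQ hx' hx) (hγ _)
  have hQ_arc : ∀ {x}, p x ∈ P.support → Disjoint (D.part {v | v ∈ Q.support}) (range (γ x)) :=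
    fun hx => D.disjoint_part_range_of_inside hf (fun hx' => hPQ hx hx') (hγ _)
  obtain ⟨P', hP'⟩ := D.joinedIn_part P fun _ hv => hv
  obtain ⟨Q', hQ'⟩ := D.joinedIn_part Q fun _ hv => hv
  rw [← range_subset_iff] at hP' hQ'
  exact hstar.not_disjoint_of_interlaced hij hjk hkl
    ((hP_arc Q.start_mem_support).mono_left hP') ((hP_arc Q.end_mem_support).mono_left hP')
    ((hQ_arc P.start_mem_support).mono_left hQ') ((hQ_arc P.end_mem_support).mono_left hQ')
    (hpart.mono hP' hQ')

theorem not_disjoint_support_of_interlaced {ι : Type*} [LinearOrder ι] {f : Set ℂ}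
    (hf : D.IsFace f) {p : ι → W} (hp : D.InCyclicOrder f p) {i j k l : ι} (hij : i < j)
    (hjk : j < k) (hkl : k < l) (P : G.Walk (p i) (p k)) (Q : G.Walk (p j) (p l)) :
    ¬ P.support.Disjoint Q.support := by
  obtain ⟨c, γ, θ, δ, -, -, hγf, hγ, hδ, hstraight, hmono, hθ⟩ := hp
  have hstar : IsStraightStar γ θ :=
    ⟨fun hij _ _ => hγ _ _ hij _ _, fun i => ⟨1, one_pos, by
      filter_upwards [Icc_mem_nhdsGE hδ, Icc_mem_nhdsGE one_pos] with t ht ht'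
      rw [Path.extend_apply _ ht', hstraight i _ ht.2, Complex.ofReal_one, one_mul]⟩, hθ⟩
  rcases hmono with hmono | hanti
  · exact D.not_disjoint_support_of_isStraightStar hf hstar hγf (hmono hij) (hmono hjk)
      (hmono hkl) P Q
  · intro hPQ
    exact D.not_disjoint_support_of_isStraightStar hf hstar hγf (hanti hkl) (hanti hjk)
      (hanti hij) Q.reverse P.reverse (by simpa using hPQ.symm)

end PlaneDrawing

/-- No two disjoint walks of `G` join `a i` to `a j` and `b i` to `b j`. -/
def NoDisjointLinkage {W ι : Type*} (G : SimpleGraph W) (a b : ι → W) : Prop :=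
  ∀ ⦃i j⦄, i ≠ j → ∀ (P : G.Walk (a i) (a j)) (Q : G.Walk (b i) (b j)),
    ¬ P.support.Disjoint Q.support

theorem PlaneDrawing.noDisjointLinkage {W : Type*} {G : SimpleGraph W} (D : PlaneDrawing G)
    {f : Set ℂ} (hf : D.IsFace f) {k : ℕ} {a b : Fin k → W}
    (hab : D.InCyclicOrder f (alternating a b)) : NoDisjointLinkage G a b := by
  have hlt : ∀ {i j : Fin k}, i < j → ∀ (P : G.Walk (a i) (a j)) (Q : G.Walk (b i) (b j)),
      ¬ P.support.Disjoint Q.support := fun {i j} hij P Q =>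
    D.not_disjoint_support_of_interlaced hf hab (i := toLex (i, 0)) (j := toLex (i, 1))
      (k := toLex (j, 0)) (l := toLex (j, 1)) (by simp [Prod.Lex.lt_iff])
      (by simp [Prod.Lex.lt_iff, hij]) (by simp [Prod.Lex.lt_iff]) P Q
  intro i j hij P Q
  rcases hij.lt_or_gt with hij | hji
  · exact hlt hij P Q
  · intro hPQ
    exact hlt hji P.reverse Q.reverse (by simpa using hPQ)

section CycleSurgery

variable {A : Type*} {ρ : Equiv.Perm A} {x y z : A}

lemma iterate_swap_mul [DecidableEq A] {m : ℕ}
    (h : ∀ l, 0 < l → l < m → ρ^[l] x ≠ x ∧ ρ^[l] x ≠ y) :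
    ∀ l < m, (Equiv.swap x y * ρ)^[l] x = ρ^[l] x := by
  intro l hl
  induction l with
  | zero => rfl
  | succ l ih =>
    obtain ⟨hx, hy⟩ := h (l + 1) l.succ_pos hl
    rw [Function.iterate_succ_apply', ih (by omega), Equiv.Perm.mul_apply,
      ← Function.iterate_succ_apply' ρ, Equiv.swap_apply_of_ne_of_ne hx hy]

lemma iterate_swap_mul_self [DecidableEq A] {m : ℕ} (hm : 0 < m)
    (h : ∀ l, 0 < l → l < m → ρ^[l] x ≠ x ∧ ρ^[l] x ≠ y) :
    (Equiv.swap x y * ρ)^[m] x = Equiv.swap x y (ρ^[m] x) := by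
  obtain ⟨m, rfl⟩ := Nat.exists_eq_succ_of_ne_zero hm.ne'
  rw [Function.iterate_succ_apply', iterate_swap_mul h m m.lt_succ_self, Equiv.Perm.mul_apply,
    ← Function.iterate_succ_apply' ρ]

variable [Finite A]

lemma sameCycle_iff_exists_iterate : ρ.SameCycle x z ↔ ∃ l : ℕ, ρ^[l] x = z := by
  constructor
  · intro h
    obtain ⟨l, -, hl⟩ := h.exists_pow_eq'
    exact ⟨l, by rw [Equiv.Perm.iterate_eq_pow, hl]⟩
  · rintro ⟨l, rfl⟩
    exact ⟨l, by simp [Equiv.Perm.iterate_eq_pow]⟩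

lemma minimalPeriod_perm_pos (ρ : Equiv.Perm A) (x : A) : 0 < Function.minimalPeriod ρ x :=
  Function.minimalPeriod_pos_of_mem_periodicPts (ρ.injective.mem_periodicPts x)

lemma sameCycle_iff_exists_lt_of_iterate_eq {m : ℕ} (hm : 0 < m) (h : ρ^[m] x = x) :
    ρ.SameCycle x z ↔ ∃ l < m, ρ^[l] x = z := by
  rw [sameCycle_iff_exists_iterate]
  constructor
  · rintro ⟨l, rfl⟩
    exact ⟨l % m, Nat.mod_lt _ hm, Function.IsPeriodicPt.iterate_mod_apply (f := ρ) h l⟩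
  · rintro ⟨l, -, h⟩
    exact ⟨l, h⟩

lemma exists_lt_minimalPeriod_of_sameCycle (h : ρ.SameCycle x z) :
    ∃ l < Function.minimalPeriod ρ x, ρ^[l] x = z :=
  (sameCycle_iff_exists_lt_of_iterate_eq (minimalPeriod_perm_pos ρ x)
    Function.iterate_minimalPeriod).1 h

lemma iterate_ne_of_lt_minimalPeriod_of_not_sameCycle (h : ¬ ρ.SameCycle x y) {l : ℕ}
    (hl : 0 < l) (hlt : l < Function.minimalPeriod ρ x) : ρ^[l] x ≠ x ∧ ρ^[l] x ≠ y :=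
  ⟨Function.not_isPeriodicPt_of_pos_of_lt_minimalPeriod hl.ne' hlt,
    fun hy => h (sameCycle_iff_exists_iterate.2 ⟨l, hy⟩)⟩

variable [DecidableEq A]

lemma sameCycle_swap_mul_iff_of_first {m : ℕ} (hxy : x ≠ y) (hm : ρ^[m] x = y)
    (hmin : ∀ l < m, ρ^[l] x ≠ y) :
    (Equiv.swap x y * ρ).SameCycle x z ↔ ∃ l < m, ρ^[l] x = z := by
  have hm0 : 0 < m := Nat.pos_of_ne_zero fun h => hxy (by rw [← hm, h]; rfl)
  have h : ∀ l, 0 < l → l < m → ρ^[l] x ≠ x ∧ ρ^[l] x ≠ y := by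
    refine fun l h0 hl => ⟨fun hx => hmin (m - l) (by omega) ?_, hmin l hl⟩
    rw [← hm]
    conv_rhs => rw [← Nat.sub_add_cancel hl.le, Function.iterate_add_apply, hx]
  rw [sameCycle_iff_exists_lt_of_iterate_eq hm0
    (by rw [iterate_swap_mul_self hm0 h, hm, Equiv.swap_apply_right])]
  exact exists_congr fun l => and_congr_right fun hl => by rw [iterate_swap_mul h l hl]

lemma sameCycle_swap_mul_of_sameCycle (h : ¬ ρ.SameCycle x y) (hz : ρ.SameCycle x z) :
    (Equiv.swap x y * ρ).SameCycle x z := by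
  obtain ⟨l, hl, rfl⟩ := exists_lt_minimalPeriod_of_sameCycle hz
  exact sameCycle_iff_exists_iterate.2
    ⟨l, iterate_swap_mul (fun _ => iterate_ne_of_lt_minimalPeriod_of_not_sameCycle h) l hl⟩

lemma sameCycle_swap_mul_of_not_sameCycle (h : ¬ ρ.SameCycle x y) :
    (Equiv.swap x y * ρ).SameCycle x y := by
  refine sameCycle_iff_exists_iterate.2 ⟨_, (iterate_swap_mul_self (minimalPeriod_perm_pos ρ x)
    fun _ => iterate_ne_of_lt_minimalPeriod_of_not_sameCycle h).trans ?_⟩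
  rw [Function.iterate_minimalPeriod, Equiv.swap_apply_left]

lemma existsUnique_first_on_cycle {T : Set A} (hx : x ∉ T) (hT : ∃ y ∈ T, ρ.SameCycle x y) :
    ∃! y, y ∈ T ∧ ∀ z ∈ T, ¬ (Equiv.swap x y * ρ).SameCycle x z := by
  classical
  have hex : ∃ m, ρ^[m] x ∈ T := by
    obtain ⟨y, hy, h⟩ := hT
    obtain ⟨m, rfl⟩ := sameCycle_iff_exists_iterate.1 h
    exact ⟨m, hy⟩
  have hspec := Nat.find_spec hex
  have hmin : ∀ l < Nat.find hex, ρ^[l] x ∉ T := fun l hl => Nat.find_min hex hl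
  set m := Nat.find hex
  have hne : ∀ {y}, y ∈ T → x ≠ y := fun hy h => hx (h ▸ hy)
  refine ⟨ρ^[m] x, ⟨hspec, fun z hz => ?_⟩, ?_⟩
  · rw [sameCycle_swap_mul_iff_of_first (hne hspec) rfl fun l hl h => hmin l hl (h ▸ hspec)]
    rintro ⟨l, hl, rfl⟩
    exact hmin l hl hz
  · rintro y ⟨hy, hyT⟩
    have hsc : ∃ n, ρ^[n] x = y := by
      by_contra h
      exact hyT y hy (sameCycle_swap_mul_of_not_sameCycle (mt sameCycle_iff_exists_iterate.1 h))
    have hmn : Nat.find hsc ≤ m := by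
      by_contra! h
      exact hyT _ hspec ((sameCycle_swap_mul_iff_of_first (hne hy) (Nat.find_spec hsc)
        fun l hl => Nat.find_min hsc hl).2 ⟨m, h, rfl⟩)
    have hnm : ¬ Nat.find hsc < m := fun h => hmin _ h ((Nat.find_spec hsc).symm ▸ hy)
    rw [← Nat.find_spec hsc, hmn.antisymm (not_lt.1 hnm)]

end CycleSurgery

section Exchange

open scoped Classical

variable {A B : Type*}

/-- The permutation `P⁻¹ Q` of a pair `(P, Q)` of bijections. Its cycles are the components of the
superposition of `P` and `Q`. -/
def ratio (p : (A ≃ B) × (A ≃ B)) : Equiv.Perm A := p.2.trans p.1.symm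

/-- The pair obtained by exchanging the values of the two bijections `p.1` and `p.2` on the cycle
through `x` of their superposition. -/
noncomputable def exchange (x : A) (p : (A ≃ B) × (A ≃ B)) : (A ≃ B) × (A ≃ B) :=
  (((ratio p).cycleOf x).trans p.1, ((ratio p).cycleOf x).symm.trans p.2)

/-- The pair obtained by exchanging the values of the first bijection at `x` and `y`. -/
noncomputable def swapFst (x y : A) (p : (A ≃ B) × (A ≃ B)) : (A ≃ B) × (A ≃ B) :=
  ((Equiv.swap x y).trans p.1, p.2)

variable {x y u : A} {p : (A ≃ B) × (A ≃ B)}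

lemma fst_ratio_apply (p : (A ≃ B) × (A ≃ B)) (u : A) : p.1 (ratio p u) = p.2 u := by
  simp [ratio]

lemma exchange_fst_of_sameCycle (h : (ratio p).SameCycle x u) : (exchange x p).1 u = p.2 u := by
  rw [exchange, Equiv.trans_apply, h.cycleOf_apply, fst_ratio_apply]

lemma exchange_snd_of_sameCycle (h : (ratio p).SameCycle x u) : (exchange x p).2 u = p.1 u := by
  have hcycle : ((ratio p).cycleOf x).symm u = (ratio p).symm u := by
    rw [Equiv.symm_apply_eq, Equiv.Perm.SameCycle.cycleOf_apply, Equiv.apply_symm_apply]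
    exact Equiv.Perm.sameCycle_symm_apply_right.2 h
  rw [exchange, Equiv.trans_apply, hcycle, ← fst_ratio_apply, Equiv.apply_symm_apply]

lemma exchange_fst_of_not_sameCycle (h : ¬ (ratio p).SameCycle x u) :
    (exchange x p).1 u = p.1 u := by
  rw [exchange, Equiv.trans_apply, Equiv.Perm.cycleOf_apply_of_not_sameCycle h]

lemma exchange_snd_of_not_sameCycle (h : ¬ (ratio p).SameCycle x u) :
    (exchange x p).2 u = p.2 u := by
  rw [exchange, Equiv.trans_apply,
    (Equiv.symm_apply_eq _).2 (Equiv.Perm.cycleOf_apply_of_not_sameCycle h).symm]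

lemma exchange_fst_self (x : A) (p : (A ≃ B) × (A ≃ B)) : (exchange x p).1 x = p.2 x :=
  exchange_fst_of_sameCycle (.refl _ x)

lemma exchange_snd_self (x : A) (p : (A ≃ B) × (A ≃ B)) : (exchange x p).2 x = p.1 x :=
  exchange_snd_of_sameCycle (.refl _ x)

lemma iterate_ratio_exchange [Finite A] (x : A) (p : (A ≃ B) × (A ≃ B)) (l : ℕ) :
    (ratio (exchange x p))^[l] x = (⇑(ratio p)⁻¹)^[l] x := by
  induction l with
  | zero => rfl
  | succ l ih =>
    rw [Function.iterate_succ_apply', Function.iterate_succ_apply', ih]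
    have hv : (ratio p).SameCycle x ((⇑(ratio p)⁻¹)^[l] x) :=
      Equiv.Perm.sameCycle_inv.1 (sameCycle_iff_exists_iterate.2 ⟨l, rfl⟩)
    set v := (⇑(ratio p)⁻¹)^[l] x
    have hv' : (ratio p).SameCycle x ((ratio p)⁻¹ v) := Equiv.Perm.sameCycle_symm_apply_right.2 hv
    apply (exchange x p).1.injective
    rw [fst_ratio_apply, exchange_snd_of_sameCycle hv, exchange_fst_of_sameCycle hv',
      ← fst_ratio_apply, Equiv.Perm.inv_def, Equiv.apply_symm_apply]

lemma sameCycle_ratio_exchange [Finite A] :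
    (ratio (exchange x p)).SameCycle x u ↔ (ratio p).SameCycle x u := by
  rw [← Equiv.Perm.sameCycle_inv (f := ratio p), sameCycle_iff_exists_iterate,
    sameCycle_iff_exists_iterate]
  simp only [iterate_ratio_exchange]

lemma exchange_involutive [Finite A] (x : A) :
    Function.Involutive (exchange x : (A ≃ B) × (A ≃ B) → _) := by
  refine fun p => Prod.ext (Equiv.ext fun u => ?_) (Equiv.ext fun u => ?_) <;>
    by_cases h : (ratio p).SameCycle x u
  · rw [exchange_fst_of_sameCycle (sameCycle_ratio_exchange.2 h), exchange_snd_of_sameCycle h]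
  · rw [exchange_fst_of_not_sameCycle (mt sameCycle_ratio_exchange.1 h),
      exchange_fst_of_not_sameCycle h]
  · rw [exchange_snd_of_sameCycle (sameCycle_ratio_exchange.2 h), exchange_fst_of_sameCycle h]
  · rw [exchange_snd_of_not_sameCycle (mt sameCycle_ratio_exchange.1 h),
      exchange_snd_of_not_sameCycle h]

lemma swapFst_involutive (x y : A) :
    Function.Involutive (swapFst x y : (A ≃ B) × (A ≃ B) → _) :=
  fun _ => Prod.ext (Equiv.ext fun _ => by simp [swapFst]) rfl

lemma swapFst_fst_left (x y : A) (p : (A ≃ B) × (A ≃ B)) : (swapFst x y p).1 x = p.1 y := by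
  simp [swapFst]

lemma swapFst_fst_right (x y : A) (p : (A ≃ B) × (A ≃ B)) : (swapFst x y p).1 y = p.1 x := by
  simp [swapFst]

lemma swapFst_fst_of_ne (hx : u ≠ x) (hy : u ≠ y) : (swapFst x y p).1 u = p.1 u := by
  simp [swapFst, Equiv.swap_apply_of_ne_of_ne hx hy]

lemma ratio_swapFst (x y : A) (p : (A ≃ B) × (A ≃ B)) :
    ratio (swapFst x y p) = Equiv.swap x y * ratio p := by
  ext u
  simp [ratio, swapFst]

/-- The bijection `P` takes values in the relation `adj` at all points outside of `X`: a perfect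
matching of a bipartite graph, up to the values at `X`, which stand for missing vertices. -/
def IsMatchingOff (adj : A → B → Prop) (X : Set A) (P : A ≃ B) : Prop :=
  ∀ u ∉ X, adj u (P u)

/-- The weight of the part of the bijection `P` outside of `X`. -/
noncomputable def weightOff {R : Type*} [CommMonoid R] [Fintype A] (c : A → B → R) (X : Set A)
    (P : A ≃ B) : R :=
  ∏ u with u ∉ X, c u (P u)

/-- The set of points where the first bijection is exempt after the exchange on the cycle through
`x`, if the two bijections of `p` were exempt on `X` and `Y`. -/
def exchangeSet (x : A) (p : (A ≃ B) × (A ≃ B)) (X Y : Set A) : Set A :=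
  {u | (ratio p).SameCycle x u}.ite Y X

lemma mem_exchangeSet {X Y : Set A} :
    u ∈ exchangeSet x p X Y ↔ if (ratio p).SameCycle x u then u ∈ Y else u ∈ X := by
  by_cases h : (ratio p).SameCycle x u <;> simp [exchangeSet, Set.ite, h]

lemma exchangeSet_pair_empty (h : ¬ (ratio p).SameCycle x y) :
    exchangeSet x p {x, y} ∅ = {y} ∧ exchangeSet x p ∅ {x, y} = {x} := by
  constructor <;> ext u <;> rw [mem_exchangeSet] <;>
    grind [Equiv.Perm.SameCycle.refl]

lemma exchangeSet_singleton_singleton (h : ¬ (ratio p).SameCycle x y) :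
    exchangeSet x p {y} {x} = {x, y} ∧ exchangeSet x p {x} {y} = ∅ := by
  constructor <;> ext u <;> rw [mem_exchangeSet] <;>
    grind [Equiv.Perm.SameCycle.refl]

lemma exchangeSet_empty_empty (x : A) (p : (A ≃ B) × (A ≃ B)) : exchangeSet x p ∅ ∅ = ∅ :=
  Set.ite_same _ _

lemma IsMatchingOff.exchange {adj : A → B → Prop} {X Y : Set A} (hP : IsMatchingOff adj X p.1)
    (hQ : IsMatchingOff adj Y p.2) (x : A) :
    IsMatchingOff adj (exchangeSet x p X Y) (exchange x p).1 ∧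
      IsMatchingOff adj (exchangeSet x p Y X) (exchange x p).2 := by
  refine ⟨fun u hu => ?_, fun u hu => ?_⟩ <;> by_cases h : (ratio p).SameCycle x u <;>
    simp only [mem_exchangeSet, h, if_true, if_false] at hu
  · exact exchange_fst_of_sameCycle h ▸ hQ u hu
  · exact exchange_fst_of_not_sameCycle h ▸ hP u hu
  · exact exchange_snd_of_sameCycle h ▸ hP u hu
  · exact exchange_snd_of_not_sameCycle h ▸ hQ u hu

lemma weightOff_exchange {R : Type*} [CommMonoid R] [Fintype A] (c : A → B → R) (X Y : Set A)
    (x : A) (p : (A ≃ B) × (A ≃ B)) :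
    weightOff c (exchangeSet x p X Y) (exchange x p).1 *
        weightOff c (exchangeSet x p Y X) (exchange x p).2 =
      weightOff c X p.1 * weightOff c Y p.2 := by
  simp only [weightOff, Finset.prod_filter, ← Finset.prod_mul_distrib]
  refine Finset.prod_congr rfl fun u _ => ?_
  by_cases h : (ratio p).SameCycle x u
  · simp only [mem_exchangeSet, h, if_true, exchange_fst_of_sameCycle h,
      exchange_snd_of_sameCycle h, mul_comm]
  · simp only [mem_exchangeSet, h, if_false, exchange_fst_of_not_sameCycle h,
      exchange_snd_of_not_sameCycle h]

end Exchange

section Condensation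

open scoped Classical

variable {A B ι : Type*} {adj : A → B → Prop} {a : ι → A} {b : ι → B} {i j : ι}
  {p q : (A ≃ B) × (A ≃ B)}

/-- The bijections of `p` are matchings, exempt on `X` and on `Y`, respectively. -/
structure IsMatchingPair (adj : A → B → Prop) (X Y : Set A) (p : (A ≃ B) × (A ≃ B)) : Prop where
  fst : IsMatchingOff adj X p.1
  snd : IsMatchingOff adj Y p.2

/-- The planarity input of the condensation identity: `a i` and `a j` lie on different cycles of the
superposition of two perfect matchings if one of them contains the edge `a j b j` and the other one
the edge `a i b i`, and also for two near-perfect matchings that miss `a i`, `b j` and `a j`, `b i`,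
if one completes them by the virtual edges `a i b j` and `a j b i`. -/
structure SeparatesCycles (adj : A → B → Prop) (a : ι → A) (b : ι → B) : Prop where
  not_sameCycle ⦃i j : ι⦄ : i ≠ j → ∀ p, IsMatchingPair adj ∅ ∅ p → p.1 (a j) = b j →
    p.2 (a i) = b i → ¬ (ratio p).SameCycle (a j) (a i)
  not_sameCycle_of_virtual ⦃i j : ι⦄ : i ≠ j → ∀ p, IsMatchingPair adj {a i} {a j} p →
    p.1 (a i) = b j → p.2 (a j) = b i → ¬ (ratio p).SameCycle (a j) (a i)

/-- On the cycle of `a j` in `ρ`, the bijection `P` contains no edge `a t b t` with `t ≠ j`. -/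
def IsAloneOnCycle (a : ι → A) (b : ι → B) (j : ι) (ρ : Equiv.Perm A) (P : A ≃ B) : Prop :=
  ∀ t ≠ j, ρ.SameCycle (a j) (a t) → P (a t) ≠ b t

/-- A pair of perfect matchings the first of which contains the edge `a j b j`, while the second
one contains none of the edges `a t b t`. -/
structure IsFirstOnly (adj : A → B → Prop) (a : ι → A) (b : ι → B) (j : ι)
    (p : (A ≃ B) × (A ≃ B)) : Prop extends IsMatchingPair adj ∅ ∅ p where
  fst_apply : p.1 (a j) = b j
  snd_ne : ∀ t, p.2 (a t) ≠ b t

/-- A pair of perfect matchings of which only the second one contains the edge `a j b j`, and the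
second one contains none of the other edges `a t b t`. -/
structure IsSecondOnly (adj : A → B → Prop) (a : ι → A) (b : ι → B) (j : ι)
    (p : (A ≃ B) × (A ≃ B)) : Prop extends IsMatchingPair adj ∅ ∅ p where
  fst_ne : p.1 (a j) ≠ b j
  snd_apply : p.2 (a j) = b j
  snd_ne : ∀ t ≠ j, p.2 (a t) ≠ b t

/-- A pair of near-perfect matchings that miss `a i`, `b j` and `a j`, `b i`, respectively, and are
completed by the virtual edges `a i b j` and `a j b i`; the second one contains none of the edges
`a t b t`. -/
structure IsCrossed (adj : A → B → Prop) (a : ι → A) (b : ι → B) (i j : ι)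
    (p : (A ≃ B) × (A ≃ B)) : Prop extends IsMatchingPair adj {a i} {a j} p where
  fst_apply : p.1 (a i) = b j
  snd_apply : p.2 (a j) = b i
  snd_ne : ∀ t, p.2 (a t) ≠ b t

/-- The stage between a pair in which the first matching contains the edges `a i b i` and `a j b j`
and a crossed pair: the first matching now contains both virtual edges `a i b j` and `a j b i`, and
these lie on different cycles. -/
structure IsHalfCrossed (adj : A → B → Prop) (a : ι → A) (b : ι → B) (i j : ι)
    (p : (A ≃ B) × (A ≃ B)) : Prop extends IsMatchingPair adj {a j, a i} ∅ p where
  fst_apply_left : p.1 (a i) = b j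
  fst_apply_right : p.1 (a j) = b i
  snd_ne : ∀ t, p.2 (a t) ≠ b t
  not_sameCycle : ¬ (ratio p).SameCycle (a j) (a i)
  isAloneOnCycle : IsAloneOnCycle a b j (ratio p) p.1

protected lemma IsMatchingPair.exchange {X Y : Set A} (h : IsMatchingPair adj X Y p) (x : A) :
    IsMatchingPair adj (exchangeSet x p X Y) (exchangeSet x p Y X) (exchange x p) :=
  ⟨(h.fst.exchange h.snd x).1, (h.fst.exchange h.snd x).2⟩

lemma IsMatchingPair.exchange_of_empty (h : IsMatchingPair adj ∅ ∅ p) (x : A) :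
    IsMatchingPair adj ∅ ∅ (exchange x p) := by
  simpa only [exchangeSet_empty_empty] using h.exchange x

lemma IsSecondOnly.isFirstOnly_exchange [Finite A] (hsep : SeparatesCycles adj a b)
    (h : IsSecondOnly adj a b j p) : IsFirstOnly adj a b j (exchange (a j) p) ∧
      IsAloneOnCycle a b j (ratio (exchange (a j) p)) (exchange (a j) p).1 := by
  have hpair := h.exchange_of_empty (a j)
  have hj := (exchange_fst_self (a j) p).trans h.snd_apply
  refine ⟨⟨hpair, hj, fun t ht => ?_⟩, fun t htj hs => ?_⟩
  · by_cases hs : (ratio p).SameCycle (a j) (a t)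
    · have htj : t ≠ j := fun htj => h.fst_ne (by rw [← htj, ← exchange_snd_of_sameCycle hs, ht])
      exact hsep.not_sameCycle htj _ hpair hj ht (sameCycle_ratio_exchange.2 hs)
    · have htj : t ≠ j := fun htj => hs (htj ▸ .refl _ _)
      exact h.snd_ne t htj (by rw [← exchange_snd_of_not_sameCycle hs, ht])
  · rw [exchange_fst_of_sameCycle (sameCycle_ratio_exchange.1 hs)]
    exact h.snd_ne t htj

lemma IsFirstOnly.isSecondOnly_exchange (h : IsFirstOnly adj a b j p)
    (halone : IsAloneOnCycle a b j (ratio p) p.1) : IsSecondOnly adj a b j (exchange (a j) p) := by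
  refine ⟨h.exchange_of_empty (a j), exchange_fst_self (a j) p ▸ h.snd_ne j,
    (exchange_snd_self (a j) p).trans h.fst_apply, fun t htj => ?_⟩
  by_cases hs : (ratio p).SameCycle (a j) (a t)
  · exact exchange_snd_of_sameCycle hs ▸ halone t htj hs
  · exact exchange_snd_of_not_sameCycle hs ▸ h.snd_ne t

lemma existsUnique_isAloneOnCycle_swap_mul [Finite A] {ρ : Equiv.Perm A} {P : A ≃ B}
    (ha : a.Injective) (h : ¬ IsAloneOnCycle a b j ρ P) :
    ∃! i, i ≠ j ∧ P (a i) = b i ∧ IsAloneOnCycle a b j (Equiv.swap (a j) (a i) * ρ) P := by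
  unfold IsAloneOnCycle at h
  push Not at h
  obtain ⟨t, htj, hts, htb⟩ := h
  obtain ⟨y, ⟨⟨i, ⟨hij, hib⟩, rfl⟩, hi⟩, huniq⟩ := existsUnique_first_on_cycle
    (ρ := ρ) (x := a j) (T := a '' {i | i ≠ j ∧ P (a i) = b i})
    (by rintro ⟨i, ⟨hij, -⟩, h⟩; exact hij (ha h)) ⟨a t, ⟨t, ⟨htj, htb⟩, rfl⟩, hts⟩
  refine ⟨i, ⟨hij, hib, fun t ht hs hb => hi (a t) ⟨t, ⟨ht, hb⟩, rfl⟩ hs⟩, ?_⟩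
  rintro i' ⟨hij', hib', halone⟩
  refine ha (huniq (a i') ⟨⟨i', ⟨hij', hib'⟩, rfl⟩, ?_⟩)
  rintro _ ⟨t, ⟨ht, hb⟩, rfl⟩ hs
  exact halone t ht hs hb

lemma IsMatchingPair.swapFst_of_empty (h : IsMatchingPair adj ∅ ∅ p) (x y : A) :
    IsMatchingPair adj {x, y} ∅ (swapFst x y p) := by
  refine ⟨fun u hu => ?_, h.snd⟩
  rw [Set.mem_insert_iff, Set.mem_singleton_iff, not_or] at hu
  rw [swapFst_fst_of_ne hu.1 hu.2]
  exact h.fst u (Set.notMem_empty u)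

lemma IsMatchingPair.swapFst_of_pair (hab : ∀ t, adj (a t) (b t))
    (h : IsMatchingPair adj {a j, a i} ∅ p) (hi : p.1 (a i) = b j) (hj : p.1 (a j) = b i) :
    IsMatchingPair adj ∅ ∅ (swapFst (a j) (a i) p) := by
  refine ⟨fun u _ => ?_, h.snd⟩
  by_cases huj : u = a j
  · rw [huj, swapFst_fst_left, hi]
    exact hab j
  by_cases hui : u = a i
  · rw [hui, swapFst_fst_right, hj]
    exact hab i
  · rw [swapFst_fst_of_ne huj hui]
    exact h.fst u (by simp [huj, hui])

lemma IsFirstOnly.isHalfCrossed_swapFst (ha : a.Injective) (hij : i ≠ j)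
    (h : IsFirstOnly adj a b j p) (hi : p.1 (a i) = b i)
    (halone : IsAloneOnCycle a b j (Equiv.swap (a j) (a i) * ratio p) p.1) :
    IsHalfCrossed adj a b i j (swapFst (a j) (a i) p) := by
  rw [← ratio_swapFst] at halone
  have hsep : ¬ (ratio (swapFst (a j) (a i) p)).SameCycle (a j) (a i) := fun hs =>
    halone i hij hs hi
  refine ⟨h.swapFst_of_empty _ _, (swapFst_fst_right _ _ p).trans h.fst_apply,
    (swapFst_fst_left _ _ p).trans hi, h.snd_ne, hsep, fun t htj hs => ?_⟩
  have hti : t ≠ i := fun hti => hsep (hti ▸ hs)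
  rw [swapFst_fst_of_ne (ha.ne htj) (ha.ne hti)]
  exact halone t htj hs

lemma IsHalfCrossed.isFirstOnly_swapFst (hab : ∀ t, adj (a t) (b t)) (ha : a.Injective)
    (h : IsHalfCrossed adj a b i j p) :
    IsFirstOnly adj a b j (swapFst (a j) (a i) p) ∧ (swapFst (a j) (a i) p).1 (a i) = b i ∧
      IsAloneOnCycle a b j (Equiv.swap (a j) (a i) * ratio (swapFst (a j) (a i) p))
        (swapFst (a j) (a i) p).1 := by
  refine ⟨⟨h.swapFst_of_pair hab h.fst_apply_left h.fst_apply_right,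
    (swapFst_fst_left _ _ p).trans h.fst_apply_left, h.snd_ne⟩,
    (swapFst_fst_right _ _ p).trans h.fst_apply_right, fun t htj hs => ?_⟩
  rw [← ratio_swapFst, swapFst_involutive] at hs
  have hti : t ≠ i := fun hti => h.not_sameCycle (hti ▸ hs)
  rw [swapFst_fst_of_ne (ha.ne htj) (ha.ne hti)]
  exact h.isAloneOnCycle t htj hs

lemma IsHalfCrossed.isCrossed_exchange (hb : b.Injective) (hij : i ≠ j)
    (h : IsHalfCrossed adj a b i j p) :
    IsCrossed adj a b i j (exchange (a j) p) := by
  have hpair := h.toIsMatchingPair.exchange (a j)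
  rw [(exchangeSet_pair_empty h.not_sameCycle).1, (exchangeSet_pair_empty h.not_sameCycle).2]
    at hpair
  refine ⟨hpair, (exchange_fst_of_not_sameCycle h.not_sameCycle).trans h.fst_apply_left,
    (exchange_snd_self (a j) p).trans h.fst_apply_right, fun t => ?_⟩
  by_cases hs : (ratio p).SameCycle (a j) (a t)
  · rw [exchange_snd_of_sameCycle hs]
    by_cases htj : t = j
    · rw [htj, h.fst_apply_right]
      exact hb.ne hij
    · exact h.isAloneOnCycle t htj hs
  · exact exchange_snd_of_not_sameCycle hs ▸ h.snd_ne t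

lemma IsCrossed.isHalfCrossed_exchange [Finite A] (hab : ∀ t, adj (a t) (b t)) (ha : a.Injective)
    (hsep : SeparatesCycles adj a b) (hij : i ≠ j) (h : IsCrossed adj a b i j p) :
    IsHalfCrossed adj a b i j (exchange (a j) p) := by
  have hp := hsep.not_sameCycle_of_virtual hij p h.toIsMatchingPair h.fst_apply h.snd_apply
  have hr : ¬ (ratio (exchange (a j) p)).SameCycle (a j) (a i) :=
    mt sameCycle_ratio_exchange.1 hp
  have hpair := h.toIsMatchingPair.exchange (a j)
  rw [(exchangeSet_singleton_singleton hp).1, (exchangeSet_singleton_singleton hp).2] at hpair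
  have hi := (exchange_fst_of_not_sameCycle hp).trans h.fst_apply
  have hj := (exchange_fst_self (a j) p).trans h.snd_apply
  refine ⟨hpair, hi, hj, fun t ht => ?_, hr, fun t _ hs => ?_⟩
  · by_cases hs : (ratio p).SameCycle (a j) (a t)
    · have htj : t ≠ j := by
        rintro rfl
        exact hij (ha (p.1.injective (h.fst_apply.trans
          (ht.symm.trans (exchange_snd_self (a t) p)))))
      -- Undoing the swap merges the two cycles, so `a t` and `a j` stay on a common cycle.
      refine hsep.not_sameCycle htj _ (hpair.swapFst_of_pair hab hi hj)
        ((swapFst_fst_left _ _ _).trans hi) ht ?_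
      rw [ratio_swapFst]
      exact sameCycle_swap_mul_of_sameCycle hr (sameCycle_ratio_exchange.2 hs)
    · exact h.snd_ne t (by rw [← exchange_snd_of_not_sameCycle hs, ht])
  · exact exchange_fst_of_sameCycle (sameCycle_ratio_exchange.1 hs) ▸ h.snd_ne t

variable {R : Type*} [Fintype A]

/-- The weight of a pair of matchings that are exempt on `X` and on `Y`, respectively. -/
noncomputable def pairWeight [CommMonoid R] (c : A → B → R) (X Y : Set A)
    (p : (A ≃ B) × (A ≃ B)) : R :=
  weightOff c X p.1 * weightOff c Y p.2

lemma pairWeight_exchange [CommMonoid R] (c : A → B → R) (X Y : Set A) (x : A)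
    (p : (A ≃ B) × (A ≃ B)) :
    pairWeight c (exchangeSet x p X Y) (exchangeSet x p Y X) (exchange x p) = pairWeight c X Y p :=
  weightOff_exchange c X Y x p

lemma weightOff_empty_eq_mul_mul_weightOff_pair [CommMonoid R] (c : A → B → R) {x y : A}
    (hxy : x ≠ y) (P : A ≃ B) :
    weightOff c ∅ P = c x (P x) * c y (P y) * weightOff c {x, y} P := by
  have hpair : ∏ u with u ∈ ({x, y} : Set A), c u (P u) = c x (P x) * c y (P y) := by
    rw [← Finset.prod_pair (f := fun u => c u (P u)) hxy]
    exact Finset.prod_congr (by ext; simp) fun _ _ => rfl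
  rw [← hpair, weightOff, weightOff, Finset.prod_filter_mul_prod_filter_not]
  exact Finset.prod_congr (by ext; simp) fun _ _ => rfl

lemma IsFirstOnly.pairWeight_swapFst [CommMonoid R] (c : A → B → R) (ha : a.Injective)
    (hij : i ≠ j) (h : IsFirstOnly adj a b j p) (hi : p.1 (a i) = b i) :
    pairWeight c ∅ ∅ p = c (a i) (b i) * c (a j) (b j) *
      pairWeight c {a j, a i} ∅ (swapFst (a j) (a i) p) := by
  have hrest : weightOff c {a j, a i} (swapFst (a j) (a i) p).1 =
      weightOff c {a j, a i} p.1 := by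
    refine Finset.prod_congr rfl fun u hu => ?_
    simp only [Finset.mem_filter, Set.mem_insert_iff, Set.mem_singleton_iff, not_or] at hu
    rw [swapFst_fst_of_ne hu.2.1 hu.2.2]
  rw [pairWeight, pairWeight, hrest,
    weightOff_empty_eq_mul_mul_weightOff_pair c (ha.ne hij.symm) p.1, h.fst_apply, hi,
    mul_comm (c (a j) (b j)), mul_assoc _ (weightOff c _ p.1)]
  rfl

lemma IsHalfCrossed.pairWeight_exchange_eq [CommMonoid R] (c : A → B → R)
    (h : IsHalfCrossed adj a b i j p) :
    pairWeight c {a i} {a j} (exchange (a j) p) = pairWeight c {a j, a i} ∅ p := by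
  rw [← pairWeight_exchange c {a j, a i} ∅ (a j) p,
    (exchangeSet_pair_empty h.not_sameCycle).1, (exchangeSet_pair_empty h.not_sameCycle).2]

variable [Fintype B] [CommSemiring R]

lemma sum_isSecondOnly (c : A → B → R) (hsep : SeparatesCycles adj a b) (j : ι) :
    ∑ p with IsSecondOnly adj a b j p, pairWeight c ∅ ∅ p =
      ∑ p with IsFirstOnly adj a b j p ∧ IsAloneOnCycle a b j (ratio p) p.1,
        pairWeight c ∅ ∅ p := by
  refine Finset.sum_nbij' (exchange (a j)) (exchange (a j)) (fun p hp => ?_) (fun p hp => ?_)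
    (fun p _ => exchange_involutive _ p) (fun p _ => exchange_involutive _ p) fun p _ => ?_
  · exact (Finset.mem_filter_univ _).2 (((Finset.mem_filter_univ _).1 hp).isFirstOnly_exchange hsep)
  · obtain ⟨h, halone⟩ := (Finset.mem_filter_univ _).1 hp
    exact (Finset.mem_filter_univ _).2 (h.isSecondOnly_exchange halone)
  · simpa only [exchangeSet_empty_empty] using (pairWeight_exchange c ∅ ∅ (a j) p).symm

lemma sum_isCrossed (c : A → B → R) (hab : ∀ t, adj (a t) (b t)) (ha : a.Injective)
    (hb : b.Injective) (hsep : SeparatesCycles adj a b) (hij : i ≠ j) :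
    c (a i) (b i) * c (a j) (b j) *
        ∑ p with IsCrossed adj a b i j p, pairWeight c {a i} {a j} p =
      ∑ p with IsFirstOnly adj a b j p ∧ p.1 (a i) = b i ∧
        IsAloneOnCycle a b j (Equiv.swap (a j) (a i) * ratio p) p.1, pairWeight c ∅ ∅ p := by
  rw [Finset.mul_sum]
  symm
  refine Finset.sum_nbij' (fun p => exchange (a j) (swapFst (a j) (a i) p))
    (fun p => swapFst (a j) (a i) (exchange (a j) p)) (fun p hp => ?_) (fun p hp => ?_)
    (fun p _ => by simp only [exchange_involutive _ _, swapFst_involutive _ _ _])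
    (fun p _ => by simp only [exchange_involutive _ _, swapFst_involutive _ _ _]) (fun p hp => ?_)
  · obtain ⟨h, hi, halone⟩ := (Finset.mem_filter_univ _).1 hp
    exact (Finset.mem_filter_univ _).2
      ((h.isHalfCrossed_swapFst ha hij hi halone).isCrossed_exchange hb hij)
  · have h := (Finset.mem_filter_univ _).1 hp
    exact (Finset.mem_filter_univ _).2
      ((h.isHalfCrossed_exchange hab ha hsep hij).isFirstOnly_swapFst hab ha)
  · obtain ⟨h, hi, halone⟩ := (Finset.mem_filter_univ _).1 hp
    rw [h.pairWeight_swapFst c ha hij hi,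
      (h.isHalfCrossed_swapFst ha hij hi halone).pairWeight_exchange_eq]

lemma sum_isFirstOnly [Fintype ι] [DecidableEq ι] (c : A → B → R) (ha : a.Injective) (j : ι) :
    ∑ p with IsFirstOnly adj a b j p, pairWeight c ∅ ∅ p =
      ∑ p with IsFirstOnly adj a b j p ∧ IsAloneOnCycle a b j (ratio p) p.1, pairWeight c ∅ ∅ p +
      ∑ i ∈ Finset.univ.erase j, ∑ p with IsFirstOnly adj a b j p ∧ p.1 (a i) = b i ∧
        IsAloneOnCycle a b j (Equiv.swap (a j) (a i) * ratio p) p.1, pairWeight c ∅ ∅ p := by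
  simp only [Finset.sum_filter]
  rw [Finset.sum_comm, ← Finset.sum_add_distrib]
  refine Finset.sum_congr rfl fun p _ => ?_
  by_cases hp : IsFirstOnly adj a b j p
  swap
  · simp only [hp, false_and, if_false, Finset.sum_const_zero, add_zero]
  simp only [hp, true_and, if_true]
  by_cases hn : IsAloneOnCycle a b j (ratio p) p.1
  · rw [if_pos hn, Finset.sum_eq_zero, add_zero]
    intro i hi
    have hij := Finset.ne_of_mem_erase hi
    refine if_neg fun ⟨hib, halone⟩ => halone i hij ?_ hib
    exact sameCycle_swap_mul_of_not_sameCycle fun h => hn i hij h hib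
  · rw [if_neg hn, zero_add]
    obtain ⟨i, ⟨hij, hib, halone⟩, huniq⟩ := existsUnique_isAloneOnCycle_swap_mul ha hn
    rw [Finset.sum_eq_single_of_mem i (by simp [hij]), if_pos ⟨hib, halone⟩]
    exact fun i' hi' hne => if_neg fun h => hne (huniq i' ⟨Finset.ne_of_mem_erase hi', h⟩)

/-- The sum of the weights of all bijections that are matchings outside of `X` and satisfy `φ`. -/
noncomputable def matchingSumOff (adj : A → B → Prop) (c : A → B → R) (X : Set A)
    (φ : (A ≃ B) → Prop) : R :=
  ∑ P with IsMatchingOff adj X P ∧ φ P, weightOff c X P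

lemma matchingSumOff_congr {adj adj' : A → B → Prop} (c : A → B → R) {X : Set A}
    {φ φ' : (A ≃ B) → Prop}
    (h : ∀ P, IsMatchingOff adj X P ∧ φ P ↔ IsMatchingOff adj' X P ∧ φ' P) :
    matchingSumOff adj c X φ = matchingSumOff adj' c X φ' :=
  Finset.sum_congr (Finset.filter_congr fun P _ => h P) fun _ _ => rfl

lemma matchingSumOff_eq_add (adj : A → B → Prop) (c : A → B → R) (X : Set A)
    (φ χ : (A ≃ B) → Prop) : matchingSumOff adj c X φ =
      matchingSumOff adj c X (fun P => φ P ∧ χ P) +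
        matchingSumOff adj c X (fun P => φ P ∧ ¬ χ P) := by
  rw [matchingSumOff, ← Finset.sum_filter_add_sum_filter_not _ χ, Finset.filter_filter,
    Finset.filter_filter]
  simp only [matchingSumOff, and_assoc]

lemma matchingSumOff_mul_matchingSumOff (adj : A → B → Prop) (c : A → B → R) (X Y : Set A)
    (φ ψ : (A ≃ B) → Prop) : matchingSumOff adj c X φ * matchingSumOff adj c Y ψ =
      ∑ p with IsMatchingPair adj X Y p ∧ φ p.1 ∧ ψ p.2, pairWeight c X Y p := by
  rw [matchingSumOff, matchingSumOff, Finset.sum_mul_sum, ← Finset.sum_product',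
    ← Finset.filter_product, Finset.univ_product_univ]
  refine Finset.sum_congr (Finset.filter_congr fun p _ => ?_) fun _ _ => rfl
  exact ⟨fun h => ⟨⟨h.1.1, h.2.1⟩, h.1.2, h.2.2⟩, fun h => ⟨⟨h.1.fst, h.2.1⟩, h.1.snd, h.2.2⟩⟩

lemma matchingSumOff_mul_eq_sum_isFirstOnly (adj : A → B → Prop) (c : A → B → R) (a : ι → A)
    (b : ι → B) (j : ι) :
    matchingSumOff adj c ∅ (fun P => P (a j) = b j) *
        matchingSumOff adj c ∅ (fun Q => ∀ t, Q (a t) ≠ b t) =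
      ∑ p with IsFirstOnly adj a b j p, pairWeight c ∅ ∅ p := by
  rw [matchingSumOff_mul_matchingSumOff]
  congr! 3 with p
  exact ⟨fun h => ⟨h.1, h.2.1, h.2.2⟩, fun h => ⟨h.1, h.2, h.3⟩⟩

lemma matchingSumOff_mul_eq_sum_isSecondOnly (adj : A → B → Prop) (c : A → B → R) (a : ι → A)
    (b : ι → B) (j : ι) :
    matchingSumOff adj c ∅ (fun P => P (a j) ≠ b j) *
        matchingSumOff adj c ∅ (fun Q => (∀ t ≠ j, Q (a t) ≠ b t) ∧ Q (a j) = b j) =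
      ∑ p with IsSecondOnly adj a b j p, pairWeight c ∅ ∅ p := by
  rw [matchingSumOff_mul_matchingSumOff]
  congr! 3 with p
  exact ⟨fun h => ⟨h.1, h.2.1, h.2.2.2, h.2.2.1⟩, fun h => ⟨h.1, h.2, h.4, h.3⟩⟩

lemma matchingSumOff_mul_eq_sum_isCrossed (adj : A → B → Prop) (c : A → B → R) (a : ι → A)
    (b : ι → B) (i j : ι) :
    matchingSumOff adj c {a i} (fun P => P (a i) = b j) *
        matchingSumOff adj c {a j} (fun Q => Q (a j) = b i ∧ ∀ t, Q (a t) ≠ b t) =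
      ∑ p with IsCrossed adj a b i j p, pairWeight c {a i} {a j} p := by
  rw [matchingSumOff_mul_matchingSumOff]
  congr! 3 with p
  exact ⟨fun h => ⟨h.1, h.2.1, h.2.2.1, h.2.2.2⟩, fun h => ⟨h.1, h.2, h.3, h.4⟩⟩

theorem matchingSumOff_condensation [Fintype ι] [DecidableEq ι] (c : A → B → R) (ha : a.Injective)
    (hb : b.Injective) (hab : ∀ t, adj (a t) (b t)) (hsep : SeparatesCycles adj a b) (j : ι) :
    matchingSumOff adj c ∅ (fun _ => True) *
        matchingSumOff adj c ∅ (fun Q => ∀ t, Q (a t) ≠ b t) =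
      matchingSumOff adj c ∅ (fun P => P (a j) ≠ b j) *
        matchingSumOff adj c ∅ (fun Q => ∀ t ≠ j, Q (a t) ≠ b t) +
      ∑ i ∈ Finset.univ.erase j, c (a i) (b i) * c (a j) (b j) *
        (matchingSumOff adj c {a i} (fun P => P (a i) = b j) *
        matchingSumOff adj c {a j} (fun Q => Q (a j) = b i ∧ ∀ t, Q (a t) ≠ b t)) := by
  have havoid : matchingSumOff adj c ∅ (fun Q => (∀ t ≠ j, Q (a t) ≠ b t) ∧ ¬ Q (a j) = b j) =
      matchingSumOff adj c ∅ (fun Q => ∀ t, Q (a t) ≠ b t) := by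
    congr! 2 with Q
    exact ⟨fun h t => if ht : t = j then ht ▸ h.2 else h.1 t ht, fun h => ⟨fun t _ => h t, h j⟩⟩
  simp only [matchingSumOff_mul_eq_sum_isCrossed]
  rw [matchingSumOff_eq_add adj c ∅ (fun _ => True) (fun P => P (a j) = b j),
    matchingSumOff_eq_add adj c ∅ (fun Q => ∀ t ≠ j, Q (a t) ≠ b t) (fun Q => Q (a j) = b j),
    havoid]
  simp only [true_and]
  rw [add_mul, mul_add, matchingSumOff_mul_eq_sum_isFirstOnly,
    matchingSumOff_mul_eq_sum_isSecondOnly, sum_isFirstOnly c ha j, sum_isSecondOnly c hsep j,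
    Finset.sum_congr rfl fun i hi =>
      sum_isCrossed c hab ha hb hsep (Finset.ne_of_mem_erase hi)]
  exact add_right_comm _ _ _

end Condensation

section Superposition

variable {W : Type*} {G : SimpleGraph W}

lemma exists_walk_support_subset {z : ℕ → W} {l m : ℕ} (hlm : l ≤ m)
    (h : ∀ n, l ≤ n → n < m → G.Adj (z n) (z (n + 1))) :
    ∃ P : G.Walk (z l) (z m), ∀ w ∈ P.support, w ∈ z '' Icc l m := by
  induction m, hlm using Nat.le_induction with
  | base => exact ⟨.nil, by simp⟩
  | succ m hm ih =>
    obtain ⟨P, hP⟩ := ih fun n hn hnm => h n hn (hnm.trans m.lt_succ_self)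
    refine ⟨P.concat (h m hm m.lt_succ_self), fun w hw => ?_⟩
    rw [SimpleGraph.Walk.support_concat, List.mem_append, List.mem_singleton] at hw
    rcases hw with hw | hw
    · exact image_mono (Icc_subset_Icc_right m.le_succ) (hP w hw)
    · exact ⟨m + 1, ⟨hm.trans m.le_succ, le_rfl⟩, hw.symm⟩

lemma exists_disjoint_walks {z : ℕ → W} {N l m l' m' : ℕ}
    (hz : ∀ n n', z n = z n' → n ≡ n' [MOD N]) (hlm : l ≤ m) (hml' : m < l') (hlm' : l' ≤ m')
    (hm' : m' < l + N) (h : ∀ n, l ≤ n → n < m → G.Adj (z n) (z (n + 1)))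
    (h' : ∀ n, l' ≤ n → n < m' → G.Adj (z n) (z (n + 1))) :
    ∃ (P : G.Walk (z l) (z m)) (Q : G.Walk (z l') (z m')), P.support.Disjoint Q.support := by
  obtain ⟨P, hP⟩ := exists_walk_support_subset hlm h
  obtain ⟨Q, hQ⟩ := exists_walk_support_subset hlm' h'
  refine ⟨P, Q, fun w hwP hwQ => ?_⟩
  obtain ⟨n, ⟨hln, hnm⟩, rfl⟩ := hP w hwP
  obtain ⟨n', ⟨hln', hnm'⟩, hn⟩ := hQ _ hwQ
  have hdvd : N ∣ n' - n := (Nat.modEq_iff_dvd' (by omega)).1 (hz n n' hn.symm)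
  exact absurd (Nat.le_of_dvd (by omega) hdvd) (by omega)

/-- The adjacency relation of `G` between the vertices in `U` and those in `V`. -/
abbrev bipartiteAdj (G : SimpleGraph W) (U V : Set W) (u : U) (v : V) : Prop := G.Adj u v

variable {U V : Set W} {X Y : Set U} {p : (U ≃ V) × (U ≃ V)} {x : U}

/-- The closed walk through `x` along the superposition of the two bijections of `p`, whose first
step is an edge of the second one. -/
noncomputable def superposedWalk (p : (U ≃ V) × (U ≃ V)) (x : U) (n : ℕ) : W :=
  if Even n then ((ratio p)^[n / 2] x : U) else (p.2 ((ratio p)^[n / 2] x) : V)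

lemma superposedWalk_two_mul (p : (U ≃ V) × (U ≃ V)) (x : U) (l : ℕ) :
    superposedWalk p x (2 * l) = ((ratio p)^[l] x : U) := by
  simp [superposedWalk]

lemma superposedWalk_two_mul_add_one (p : (U ≃ V) × (U ≃ V)) (x : U) (l : ℕ) :
    superposedWalk p x (2 * l + 1) = (p.2 ((ratio p)^[l] x) : V) := by
  rw [superposedWalk, if_neg (by simp), show (2 * l + 1) / 2 = l by omega]

lemma superposedWalk_two_mul_sub_one (p : (U ≃ V) × (U ≃ V)) (x : U) {l : ℕ} (hl : 0 < l) :
    superposedWalk p x (2 * l - 1) = (p.1 ((ratio p)^[l] x) : V) := by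
  obtain ⟨l, rfl⟩ := Nat.exists_eq_succ_of_ne_zero hl.ne'
  rw [Function.iterate_succ_apply', fst_ratio_apply, ← superposedWalk_two_mul_add_one]
  rfl

lemma modEq_of_superposedWalk_eq [Finite U] (hUV : Disjoint U V) {n n' : ℕ}
    (h : superposedWalk p x n = superposedWalk p x n') :
    n ≡ n' [MOD 2 * Function.minimalPeriod (ratio p) x] := by
  have hd : ∀ (u : U) (v : V), (u : W) ≠ v := fun u v huv =>
    Set.disjoint_left.1 hUV u.2 (huv ▸ v.2)
  have hmod : ∀ l l', (ratio p)^[l] x = (ratio p)^[l'] x →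
      l ≡ l' [MOD Function.minimalPeriod (ratio p) x] := fun l l' hll' => by
    have hpos := minimalPeriod_perm_pos (ratio p) x
    rwa [Nat.ModEq, ← Function.iterate_eq_iterate_iff_of_lt_minimalPeriod (Nat.mod_lt l hpos)
      (Nat.mod_lt l' hpos), Function.iterate_mod_minimalPeriod_eq,
      Function.iterate_mod_minimalPeriod_eq]
  obtain ⟨l, rfl | rfl⟩ := n.even_or_odd' <;> obtain ⟨l', rfl | rfl⟩ := n'.even_or_odd' <;>
    simp only [superposedWalk_two_mul, superposedWalk_two_mul_add_one] at h
  · exact (hmod l l' (Subtype.ext h)).mul_left' 2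
  · exact absurd h (hd _ _)
  · exact absurd h.symm (hd _ _)
  · exact ((hmod l l' (p.2.injective (Subtype.ext h))).mul_left' 2).add_right 1

lemma IsMatchingPair.adj_superposedWalk (hp : IsMatchingPair (bipartiteAdj G U V) X Y p) (n : ℕ)
    (hY : ∀ y ∈ Y, superposedWalk p x n ≠ y) (hX : ∀ y ∈ X, superposedWalk p x (n + 1) ≠ y) :
    G.Adj (superposedWalk p x n) (superposedWalk p x (n + 1)) := by
  obtain ⟨l, rfl | rfl⟩ := n.even_or_odd'
  · rw [superposedWalk_two_mul] at hY ⊢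
    rw [superposedWalk_two_mul_add_one]
    exact hp.snd _ fun hmem => hY _ hmem rfl
  · rw [show 2 * l + 1 + 1 = 2 * (l + 1) by ring, superposedWalk_two_mul] at hX ⊢
    rw [← Nat.add_sub_cancel (n := 2 * l + 1) (m := 1),
      show 2 * l + 1 + 1 = 2 * (l + 1) by ring, superposedWalk_two_mul_sub_one p x l.succ_pos]
    exact (hp.fst _ fun hmem => hX _ hmem rfl).symm

variable {ι : Type*} {a : ι → U} {b : ι → V} {i j : ι} [Finite U]

lemma NoDisjointLinkage.not_sameCycle
    (hlink : NoDisjointLinkage G (fun i => (a i : W)) fun i => (b i : W)) (hUV : Disjoint U V)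
    (hij : i ≠ j) (hp : IsMatchingPair (bipartiteAdj G U V) ∅ ∅ p) (hj : p.1 (a j) = b j)
    (hi : p.2 (a i) = b i) : ¬ (ratio p).SameCycle (a j) (a i) := by
  intro hs
  obtain ⟨m, hm, hmi⟩ := exists_lt_minimalPeriod_of_sameCycle hs
  have hN := minimalPeriod_perm_pos (ratio p) (a j)
  have hper := Function.iterate_minimalPeriod (f := ratio p) (x := a j)
  have hz := fun n n' => modEq_of_superposedWalk_eq (p := p) (x := a j) hUV (n := n) (n' := n')
  set N := Function.minimalPeriod (ratio p) (a j)
  have hadj : ∀ n, G.Adj (superposedWalk p (a j) n) (superposedWalk p (a j) (n + 1)) := fun n =>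
    hp.adj_superposedWalk n (by simp) (by simp)
  have h := exists_disjoint_walks hz (l := 2 * 0) (m := 2 * m) (l' := 2 * m + 1)
    (m' := 2 * N - 1) (by omega) (by omega) (by omega) (by omega) (fun n _ _ => hadj n)
    (fun n _ _ => hadj n)
  rw [superposedWalk_two_mul, superposedWalk_two_mul, superposedWalk_two_mul_add_one,
    superposedWalk_two_mul_sub_one p _ hN, hmi, hper, hi, hj] at h
  obtain ⟨P, Q, hPQ⟩ := h
  exact hlink hij.symm P Q.reverse (by simpa [SimpleGraph.Walk.support_reverse] using hPQ)

lemma NoDisjointLinkage.not_sameCycle_of_virtual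
    (hlink : NoDisjointLinkage G (fun i => (a i : W)) fun i => (b i : W)) (hUV : Disjoint U V)
    (ha : a.Injective) (hij : i ≠ j) (hp : IsMatchingPair (bipartiteAdj G U V) {a i} {a j} p)
    (hi : p.1 (a i) = b j) (hj : p.2 (a j) = b i) : ¬ (ratio p).SameCycle (a j) (a i) := by
  intro hs
  obtain ⟨m, hm, hmi⟩ := exists_lt_minimalPeriod_of_sameCycle hs
  have hm0 : 0 < m := Nat.pos_of_ne_zero fun h => hij.symm (ha (by simpa [h] using hmi))
  have hper := Function.iterate_minimalPeriod (f := ratio p) (x := a j)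
  have hz := fun n n' => modEq_of_superposedWalk_eq (p := p) (x := a j) hUV (n := n) (n' := n')
  set N := Function.minimalPeriod (ratio p) (a j)
  have hne : ∀ n n', n < n' → n' < n + 2 * N →
      superposedWalk p (a j) n ≠ superposedWalk p (a j) n' := fun n n' hn hn' h =>
    absurd (Nat.le_of_dvd (by omega) ((Nat.modEq_iff_dvd' hn.le).1 (hz n n' h))) (by omega)
  have haj : (a j : W) = superposedWalk p (a j) (2 * 0) := by rw [superposedWalk_two_mul]; rfl
  have hai : (a i : W) = superposedWalk p (a j) (2 * m) := by rw [superposedWalk_two_mul, hmi]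
  -- The only missing edges are the virtual ones, at the steps `0` and `2 * m - 1`.
  have hadj : ∀ n, 0 < n → n < 2 * N → n + 1 ≠ 2 * m →
      G.Adj (superposedWalk p (a j) n) (superposedWalk p (a j) (n + 1)) := by
    refine fun n hn hnN hnm => hp.adj_superposedWalk n ?_ ?_ <;> rintro _ rfl
    · exact haj ▸ (hne _ _ hn (by omega)).symm
    · rw [hai]
      rcases hnm.lt_or_gt with h | h
      · exact hne _ _ h (by omega)
      · exact (hne _ _ h (by omega)).symm
  have h := exists_disjoint_walks hz (l := 2 * 0 + 1) (m := 2 * m - 1) (l' := 2 * m)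
    (m' := 2 * N) (by omega) (by omega) (by omega) (by omega)
    (fun n _ _ => hadj n (by omega) (by omega) (by omega))
    (fun n _ _ => hadj n (by omega) (by omega) (by omega))
  rw [superposedWalk_two_mul, superposedWalk_two_mul, superposedWalk_two_mul_add_one,
    superposedWalk_two_mul_sub_one p _ hm0, hmi, hper, Function.iterate_zero_apply, hi, hj] at h
  obtain ⟨P, Q, hPQ⟩ := h
  exact hlink hij Q P hPQ.symm

lemma NoDisjointLinkage.separatesCycles
    (hlink : NoDisjointLinkage G (fun i => (a i : W)) fun i => (b i : W)) (hUV : Disjoint U V)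
    (ha : a.Injective) : SeparatesCycles (bipartiteAdj G U V) a b :=
  ⟨fun _ _ hij _ => hlink.not_sameCycle hUV hij,
    fun _ _ hij _ => hlink.not_sameCycle_of_virtual hUV ha hij⟩

end Superposition

section PerfectMatchings

open scoped Classical

variable {W R : Type*} {G : SimpleGraph W} {H : G.Subgraph} {U V : Set W} {M : Finset (Sym2 W)}

lemma sym2_mk_eq_mk_iff_of_disjoint (hUV : Disjoint U V) {u u' : U} {v v' : V} :
    s((u : W), (v : W)) = s((u' : W), (v' : W)) ↔ u = u' ∧ v = v' := by
  rw [Sym2.eq_iff, Subtype.coe_inj, Subtype.coe_inj]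
  exact or_iff_left fun h => Set.disjoint_left.1 hUV u.2 (h.1 ▸ v'.2)

lemma exists_eq_mk_of_mem_edgeSet (hG : G.IsBipartiteWith U V) {e : Sym2 W} (he : e ∈ H.edgeSet) :
    ∃ (u : U) (v : V), e = s((u : W), (v : W)) := by
  induction e with
  | _ x y =>
    rcases hG.mem_of_adj (H.adj_sub he) with ⟨hx, hy⟩ | ⟨hx, hy⟩
    · exact ⟨⟨x, hx⟩, ⟨y, hy⟩, rfl⟩
    · exact ⟨⟨y, hy⟩, ⟨x, hx⟩, Sym2.eq_swap⟩

lemma existsUnique_edge_mem_iff (hG : G.IsBipartiteWith U V) (hM : ∀ e ∈ M, e ∈ H.edgeSet)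
    (u : U) :
    (∃! e, e ∈ M ∧ (u : W) ∈ e) ↔ ∃! v : V, s((u : W), (v : W)) ∈ M := by
  have hmk : ∀ e ∈ M, (u : W) ∈ e → ∃ v : V, e = s((u : W), (v : W)) := by
    intro e he hu
    obtain ⟨u', v, rfl⟩ := exists_eq_mk_of_mem_edgeSet hG (hM e he)
    obtain h | h := Sym2.mem_iff.1 hu
    · exact ⟨v, by rw [h]⟩
    · exact absurd v.2 (Set.disjoint_left.1 hG.disjoint (h ▸ u.2))
  constructor
  · rintro ⟨e, ⟨he, hu⟩, huniq⟩
    obtain ⟨v, rfl⟩ := hmk e he hu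
    exact ⟨v, he, fun v' hv' => ((sym2_mk_eq_mk_iff_of_disjoint hG.disjoint).1
      (huniq _ ⟨hv', Sym2.mem_mk_left _ _⟩)).2⟩
  · rintro ⟨v, hv, huniq⟩
    refine ⟨s((u : W), (v : W)), ⟨hv, Sym2.mem_mk_left _ _⟩, ?_⟩
    rintro e ⟨he, hu⟩
    obtain ⟨v', rfl⟩ := hmk e he hu
    rw [huniq v' he]

lemma isPerfectMatchingOf_iff (hUV : U ∪ V = Set.univ) (hG : G.IsBipartiteWith U V) :
    IsPerfectMatchingOf H M ↔ (∀ e ∈ M, e ∈ H.edgeSet) ∧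
      (∀ u : U, (u : W) ∈ H.verts → ∃! v : V, s((u : W), (v : W)) ∈ M) ∧
      ∀ v : V, (v : W) ∈ H.verts → ∃! u : U, s((u : W), (v : W)) ∈ M := by
  refine and_congr_right fun hM => ?_
  have hV (v : V) : (∃! e, e ∈ M ∧ (v : W) ∈ e) ↔ ∃! u : U, s((u : W), (v : W)) ∈ M := by
    simpa only [Sym2.eq_swap (a := (v : W))] using existsUnique_edge_mem_iff hG.symm hM v
  simp only [← existsUnique_edge_mem_iff hG hM, ← hV]
  refine ⟨fun h => ⟨fun u => h u, fun v => h v⟩, fun h w => ?_⟩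
  rcases hUV.symm ▸ Set.mem_univ w with hw | hw
  · exact h.1 ⟨w, hw⟩
  · exact h.2 ⟨w, hw⟩

lemma exists_equiv_of_existsUnique {A B : Type*} {r : A → B → Prop} (hA : ∀ x, ∃! y, r x y)
    (hB : ∀ y, ∃! x, r x y) : ∃ P : A ≃ B, ∀ x y, P x = y ↔ r x y := by
  choose F hF huniq using hA
  have hFr : ∀ x y, F x = y ↔ r x y := fun x y => ⟨fun h => h ▸ hF x, fun h => (huniq x y h).symm⟩
  refine ⟨Equiv.ofBijective F ((Function.bijective_iff_existsUnique F).2 fun y => ?_), hFr⟩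
  simpa only [hFr] using hB y

variable {X : Set U} {g : U → V} {P Q : U ≃ V}

lemma IsPerfectMatchingOf.exists_equiv (hUV : U ∪ V = Set.univ) (hG : G.IsBipartiteWith U V)
    (hU : ∀ u : U, (u : W) ∈ H.verts ↔ u ∉ X) (hV : ∀ v : V, (v : W) ∈ H.verts ↔ v ∉ g '' X)
    (hg : Set.InjOn g X) (hM : IsPerfectMatchingOf H M) :
    ∃ P : U ≃ V, ∀ u v, P u = v ↔ if u ∈ X then g u = v else s((u : W), (v : W)) ∈ M := by
  obtain ⟨hMH, hMU, hMV⟩ := (isPerfectMatchingOf_iff hUV hG).1 hM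
  have hadj : ∀ (u : U) (v : V), s((u : W), (v : W)) ∈ M → H.Adj u v := fun u v h => hMH _ h
  refine exists_equiv_of_existsUnique (fun u => ?_) fun v => ?_
  · by_cases hu : u ∈ X
    · simp only [hu, if_true, existsUnique_eq']
    · simpa only [hu, if_false] using hMU u ((hU u).2 hu)
  · by_cases hv : v ∈ g '' X
    · obtain ⟨x, hx, rfl⟩ := hv
      refine ⟨x, by simp only [hx, if_true], fun u hu => ?_⟩
      beta_reduce at hu
      split_ifs at hu with huX
      · exact hg huX hx hu
      · exact absurd (mem_image_of_mem g hx) ((hV _).1 (hadj u _ hu).snd_mem)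
    · obtain ⟨u, hu, huniq⟩ := hMV v ((hV v).2 hv)
      have huX := (hU u).1 (hadj u v hu).fst_mem
      refine ⟨u, by simpa only [huX, if_false] using hu, fun u' hu' => ?_⟩
      beta_reduce at hu'
      split_ifs at hu' with huX'
      · exact absurd ⟨u', huX', hu'⟩ hv
      · exact huniq u' hu'

lemma isMatchingOff_deleteVerts_deleteEdges_iff {ι : Type*} {a : ι → U} {b : ι → V} {T : Set ι}
    {Z : Set W} (hUV : Disjoint U V) (hU : ∀ u : U, (u : W) ∈ Z ↔ u ∈ X)
    (hV : ∀ v : V, (v : W) ∈ Z ↔ v ∈ P '' X) (hT : ∀ t ∈ T, a t ∉ X) :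
    IsMatchingOff (bipartiteAdj (((⊤ : G.Subgraph).deleteVerts Z).deleteEdges
        ((fun t => s((a t : W), (b t : W))) '' T)).spanningCoe U V) X P ↔
      IsMatchingOff (bipartiteAdj G U V) X P ∧ ∀ t ∈ T, P (a t) ≠ b t := by
  have hmem {u : U} {v : V} : s((u : W), (v : W)) ∈ (fun t => s((a t : W), (b t : W))) '' T ↔
      ∃ t ∈ T, a t = u ∧ b t = v := by
    simp only [Set.mem_image, sym2_mk_eq_mk_iff_of_disjoint hUV]
  simp only [IsMatchingOff, bipartiteAdj, SimpleGraph.Subgraph.spanningCoe_adj,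
    SimpleGraph.Subgraph.deleteEdges_adj, SimpleGraph.Subgraph.deleteVerts_adj,
    SimpleGraph.Subgraph.top_adj, SimpleGraph.Subgraph.verts_top, Set.mem_univ, true_and, hU, hV,
    hmem, P.injective.mem_set_image]
  refine ⟨fun h => ⟨fun u hu => (h u hu).1.2.2, fun t ht hP => ?_⟩, fun h u hu =>
    ⟨⟨hu, hu, h.1 u hu⟩, ?_⟩⟩
  · exact (h (a t) (hT t ht)).2 ⟨t, ht, rfl, hP.symm⟩
  · rintro ⟨t, ht, rfl, hP⟩
    exact h.2 t ht hP.symm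

variable [Fintype W]

/-- The edges of the perfect matching that is given by the bijection `P` outside of `X`. -/
noncomputable def edgesOff (X : Set U) (P : U ≃ V) : Finset (Sym2 W) :=
  (Finset.univ.filter fun u : U => u ∉ X).image fun u : U => s((u : W), (P u : W))

lemma mk_mem_edgesOff (hUV : Disjoint U V) {u : U} {v : V} :
    s((u : W), (v : W)) ∈ edgesOff X P ↔ u ∉ X ∧ P u = v := by
  simp only [edgesOff, Finset.mem_image, Finset.mem_filter_univ,
    sym2_mk_eq_mk_iff_of_disjoint hUV]
  exact ⟨by rintro ⟨u, hu, rfl, hv⟩; exact ⟨hu, hv⟩, fun h => ⟨u, h.1, rfl, h.2⟩⟩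

/-- The weight of the edge between a vertex of `U` and a vertex of `V`. -/
abbrev bipartiteWeight (ω : Sym2 W → R) (U V : Set W) (u : U) (v : V) : R := ω s((u : W), (v : W))

lemma prod_edgesOff [CommMonoid R] (hUV : Disjoint U V) (ω : Sym2 W → R) (X : Set U) (P : U ≃ V) :
    ∏ e ∈ edgesOff X P, ω e = weightOff (bipartiteWeight ω U V) X P :=
  Finset.prod_image fun _ _ _ _ h => ((sym2_mk_eq_mk_iff_of_disjoint hUV).1 h).1

lemma eq_of_edgesOff_eq (hUV : Disjoint U V) (hP : Set.EqOn P g X) (hQ : Set.EqOn Q g X)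
    (h : edgesOff X P = edgesOff X Q) : P = Q := by
  ext1 u
  by_cases hu : u ∈ X
  · rw [hP hu, hQ hu]
  · exact ((mk_mem_edgesOff hUV).1 (h ▸ (mk_mem_edgesOff hUV).2 ⟨hu, rfl⟩)).2.symm

lemma isPerfectMatchingOf_edgesOff (hUV : U ∪ V = Set.univ) (hG : G.IsBipartiteWith U V)
    (hU : ∀ u : U, (u : W) ∈ H.verts ↔ u ∉ X) (hV : ∀ v : V, (v : W) ∈ H.verts ↔ v ∉ g '' X)
    (hPg : Set.EqOn P g X) (hP : IsMatchingOff (bipartiteAdj H.spanningCoe U V) X P) :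
    IsPerfectMatchingOf H (edgesOff X P) := by
  refine (isPerfectMatchingOf_iff hUV hG).2 ⟨fun e he => ?_, fun u hu => ?_, fun v hv => ?_⟩
  · simp only [edgesOff, Finset.mem_image, Finset.mem_filter_univ] at he
    obtain ⟨u, hu, rfl⟩ := he
    exact hP u hu
  · simp only [mk_mem_edgesOff hG.disjoint, (hU u).1 hu, not_false_eq_true, true_and,
      existsUnique_eq']
  · have hX : P.symm v ∉ X := fun h => (hV v).1 hv ⟨_, h, by rw [← hPg h, P.apply_symm_apply]⟩
    simp only [mk_mem_edgesOff hG.disjoint]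
    exact ⟨P.symm v, ⟨hX, P.apply_symm_apply v⟩, fun u hu => P.eq_symm_apply.2 hu.2⟩

lemma IsPerfectMatchingOf.exists_edgesOff_eq (hUV : U ∪ V = Set.univ) (hG : G.IsBipartiteWith U V)
    (hU : ∀ u : U, (u : W) ∈ H.verts ↔ u ∉ X) (hV : ∀ v : V, (v : W) ∈ H.verts ↔ v ∉ g '' X)
    (hg : Set.InjOn g X) (hM : IsPerfectMatchingOf H M) :
    ∃ P : U ≃ V, (IsMatchingOff (bipartiteAdj H.spanningCoe U V) X P ∧ Set.EqOn P g X) ∧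
      edgesOff X P = M := by
  obtain ⟨P, hP⟩ := hM.exists_equiv hUV hG hU hV hg
  have hPM : ∀ u : U, u ∉ X → s((u : W), (P u : W)) ∈ M := fun u hu =>
    by simpa only [hu, if_false] using (hP u (P u)).1 rfl
  refine ⟨P, ⟨fun u hu => hM.1 _ (hPM u hu), fun u hu => (hP u _).2 (by simp only [hu, if_true])⟩,
    Finset.Subset.antisymm (Finset.image_subset_iff.2 fun u hu => ?_) fun e he => ?_⟩
  · exact hPM u (Finset.mem_filter.1 hu).2
  · obtain ⟨u, v, rfl⟩ := exists_eq_mk_of_mem_edgeSet hG (hM.1 e he)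
    have hu : u ∉ X := (hU u).1 (H.edge_vert (hM.1 _ he))
    exact (mk_mem_edgesOff hG.disjoint).2 ⟨hu, (hP u v).2 (by simpa only [hu, if_false] using he)⟩

variable [CommRing R]

lemma matchingSum_eq_matchingSumOff (ω : Sym2 W → R) (hUV : U ∪ V = Set.univ)
    (hG : G.IsBipartiteWith U V) (hU : ∀ u : U, (u : W) ∈ H.verts ↔ u ∉ X)
    (hV : ∀ v : V, (v : W) ∈ H.verts ↔ v ∉ g '' X) (hg : Set.InjOn g X) :
    matchingSum ω H = matchingSumOff (bipartiteAdj H.spanningCoe U V) (bipartiteWeight ω U V) X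
      fun P => Set.EqOn P g X := by
  symm
  refine Finset.sum_bij (fun P _ => edgesOff X P) (fun P hP => ?_) (fun P hP Q hQ h => ?_)
    (fun M hM => ?_) fun P _ => (prod_edgesOff hG.disjoint ω X P).symm
  · have hP' := (Finset.mem_filter.1 hP).2
    exact Finset.mem_filter.2
      ⟨Finset.mem_univ _, isPerfectMatchingOf_edgesOff hUV hG hU hV hP'.2 hP'.1⟩
  · exact eq_of_edgesOff_eq hG.disjoint (Finset.mem_filter.1 hP).2.2
      (Finset.mem_filter.1 hQ).2.2 h
  · obtain ⟨P, hP, hPM⟩ := (Finset.mem_filter.1 hM).2.exists_edgesOff_eq hUV hG hU hV hg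
    exact ⟨P, by simpa only [Finset.mem_filter_univ] using hP, hPM⟩

lemma matchingSum_deleteVerts_deleteEdges {ι : Type*} {a : ι → U} {b : ι → V} {T : Set ι}
    {Z : Set W} (ω : Sym2 W → R) (hUV : U ∪ V = Set.univ) (hG : G.IsBipartiteWith U V)
    (hU : ∀ u : U, (u : W) ∈ Z ↔ u ∈ X) (hV : ∀ v : V, (v : W) ∈ Z ↔ v ∈ g '' X)
    (hg : Set.InjOn g X) (hT : ∀ t ∈ T, a t ∉ X) :
    matchingSum ω (((⊤ : G.Subgraph).deleteVerts Z).deleteEdges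
        ((fun t => s((a t : W), (b t : W))) '' T)) =
      matchingSumOff (bipartiteAdj G U V) (bipartiteWeight ω U V) X
        fun P => Set.EqOn P g X ∧ ∀ t ∈ T, P (a t) ≠ b t := by
  rw [matchingSum_eq_matchingSumOff (X := X) (g := g) ω hUV hG
    (fun u => by simp only [SimpleGraph.Subgraph.deleteEdges_verts,
      SimpleGraph.Subgraph.deleteVerts_verts, SimpleGraph.Subgraph.verts_top, Set.mem_sdiff,
      Set.mem_univ, true_and, hU])
    (fun v => by simp only [SimpleGraph.Subgraph.deleteEdges_verts,
      SimpleGraph.Subgraph.deleteVerts_verts, SimpleGraph.Subgraph.verts_top, Set.mem_sdiff,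
      Set.mem_univ, true_and, hV]) hg]
  refine matchingSumOff_congr _ fun P => ?_
  rw [and_comm, and_left_comm]
  exact and_congr_right fun hPg => isMatchingOff_deleteVerts_deleteEdges_iff hG.disjoint hU
    (fun v => by rw [hV, hPg.image_eq]) hT

lemma matchingSum_deleteEdges {ι : Type*} [Nonempty ι] (ω : Sym2 W → R) (a : ι → U) (b : ι → V)
    (T : Set ι) (hUV : U ∪ V = Set.univ) (hG : G.IsBipartiteWith U V) :
    matchingSum ω ((⊤ : G.Subgraph).deleteEdges ((fun t => s((a t : W), (b t : W))) '' T)) =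
      matchingSumOff (bipartiteAdj G U V) (bipartiteWeight ω U V) ∅
        fun P => ∀ t ∈ T, P (a t) ≠ b t := by
  have h := matchingSum_deleteVerts_deleteEdges (X := ∅) (Z := ∅) (T := T) (b := b)
    (g := fun _ => b (Classical.arbitrary ι)) ω hUV hG
    (fun u => by simp only [Set.mem_empty_iff_false])
    (fun v => by simp only [Set.mem_empty_iff_false, Set.image_empty]) (Set.injOn_empty _)
    fun t _ => Set.notMem_empty (a t)
  simpa only [SimpleGraph.Subgraph.deleteVerts_empty, Set.eqOn_empty, true_and] using h

lemma matchingSum_deletePair_deleteEdges {ι : Type*} {a : ι → U} {b : ι → V} {T : Set ι} {u : U}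
    {v : V} (ω : Sym2 W → R) (hUV : U ∪ V = Set.univ) (hG : G.IsBipartiteWith U V)
    (hT : ∀ t ∈ T, a t ≠ u) :
    matchingSum ω (((⊤ : G.Subgraph).deleteVerts {(u : W), (v : W)}).deleteEdges
        ((fun t => s((a t : W), (b t : W))) '' T)) =
      matchingSumOff (bipartiteAdj G U V) (bipartiteWeight ω U V) {u}
        fun P => P u = v ∧ ∀ t ∈ T, P (a t) ≠ b t := by
  have hd := Set.disjoint_left.1 hG.disjoint
  rw [matchingSum_deleteVerts_deleteEdges (X := {u}) (g := fun _ => v) ω hUV hG (fun x => ?_)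
    (fun y => ?_) (Set.injOn_singleton _ _) hT]
  · simp only [Set.eqOn_singleton]
  · rw [Set.mem_insert_iff, Set.mem_singleton_iff, Set.mem_singleton_iff, Subtype.coe_inj]
    exact or_iff_left fun h => hd x.2 (h ▸ v.2)
  · rw [Set.image_singleton, Set.mem_insert_iff, Set.mem_singleton_iff, Set.mem_singleton_iff,
      Subtype.coe_inj]
    exact or_iff_right fun h => hd u.2 (h ▸ y.2)

lemma matchingSum_deletePair (ω : Sym2 W → R) (hUV : U ∪ V = Set.univ)
    (hG : G.IsBipartiteWith U V) (u : U) (v : V) :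
    matchingSum ω ((⊤ : G.Subgraph).deleteVerts {(u : W), (v : W)}) =
      matchingSumOff (bipartiteAdj G U V) (bipartiteWeight ω U V) {u} fun P => P u = v := by
  have h := matchingSum_deletePair_deleteEdges (a := Empty.elim) (b := Empty.elim) (T := ∅) (u := u)
    (v := v) ω hUV hG fun t => t.elim
  simpa only [Set.image_empty, SimpleGraph.Subgraph.deleteEdges_empty_eq, Set.mem_empty_iff_false,
    false_imp_iff, implies_true, and_true] using h

lemma matchingSum_deletePair_deleteEdges_compl {ι : Type*} {a : ι → U} {b : ι → V} {i j : ι}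
    (ω : Sym2 W → R) (hUV : U ∪ V = Set.univ) (hG : G.IsBipartiteWith U V) (ha : a.Injective)
    (hb : b.Injective) (hij : i ≠ j) :
    matchingSum ω (((⊤ : G.Subgraph).deleteVerts {(a j : W), (b i : W)}).deleteEdges
        ((fun t => s((a t : W), (b t : W))) '' {i, j}ᶜ)) =
      matchingSumOff (bipartiteAdj G U V) (bipartiteWeight ω U V) {a j}
        fun P => P (a j) = b i ∧ ∀ t, P (a t) ≠ b t := by
  have hne : ∀ t ∈ ({i, j}ᶜ : Set ι), a t ≠ a j := fun t ht => ha.ne fun h => ht (Or.inr h)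
  rw [matchingSum_deletePair_deleteEdges ω hUV hG hne]
  refine matchingSumOff_congr _ fun P => and_congr_right fun _ => and_congr_right fun hPj =>
    ⟨fun h t ht => ?_, fun h t _ => h t⟩
  have htj : t ≠ j := fun htj => hij (hb (hPj.symm.trans (htj ▸ ht)))
  have hti : t ≠ i := fun hti => htj (ha (P.injective (ht.trans (hti ▸ hPj.symm))))
  exact h t (not_or.2 ⟨hti, htj⟩) ht

end PerfectMatchings

lemma injective_of_pairwise_disjoint {ι W : Type*} {s : ι → Set W} {a : ι → W}
    (hs : Pairwise fun i j => Disjoint (s i) (s j)) (ha : ∀ i, a i ∈ s i) : a.Injective :=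
  fun i j h => hs.eq fun hd => Set.disjoint_left.1 hd (ha i) (h ▸ ha j)

theorem corollary3p4_general {W R ι : Type*} [Fintype W] [CommRing R] [Fintype ι] [DecidableEq ι]
    (G : SimpleGraph W) (ω : Sym2 W → R) (U V : Set W) (hUV : U ∪ V = Set.univ)
    (hG : G.IsBipartiteWith U V) (a b : ι → W) (hab : ∀ i, G.Adj (a i) (b i))
    (ha : a.Injective) (hb : b.Injective) (hA : ∀ i, a i ∈ U) (hB : ∀ i, b i ∈ V)
    (hlink : NoDisjointLinkage G a b) (e : ι → Sym2 W) (he : ∀ i, e i = s(a i, b i)) (j : ι) :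
    matchingSum ω (⊤ : G.Subgraph) *
        matchingSum ω ((⊤ : G.Subgraph).deleteEdges (Set.range e)) =
      matchingSum ω ((⊤ : G.Subgraph).deleteEdges {e j}) *
          matchingSum ω ((⊤ : G.Subgraph).deleteEdges (e '' {j}ᶜ)) +
        ∑ i ∈ Finset.univ.erase j,
          ω (e i) * ω (e j) *
            matchingSum ω ((⊤ : G.Subgraph).deleteVerts {a i, b j}) *
            matchingSum ω
              (((⊤ : G.Subgraph).deleteVerts {a j, b i}).deleteEdges (e '' {i, j}ᶜ)) := by
  classical
  lift a to ι → U using hA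
  lift b to ι → V using hB
  obtain rfl : e = fun i => s((a i : W), (b i : W)) := funext he
  have ha' : a.Injective := ha.of_comp
  have hb' : b.Injective := hb.of_comp
  have : Nonempty ι := ⟨j⟩
  have hM (T : Set ι) := matchingSum_deleteEdges ω a b T hUV hG
  have hM_empty := hM ∅
  have hM_univ := hM Set.univ
  have hM_singleton := hM {j}
  rw [Set.image_empty, SimpleGraph.Subgraph.deleteEdges_empty_eq] at hM_empty
  rw [Set.image_univ] at hM_univ
  rw [Set.image_singleton] at hM_singleton
  rw [hM_empty, hM_univ, hM_singleton, hM]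
  simp only [Set.mem_empty_iff_false, false_imp_iff, implies_true, Set.mem_univ,
    true_imp_iff, Set.mem_singleton_iff, forall_eq, Set.mem_compl_iff]
  rw [matchingSumOff_condensation (bipartiteWeight ω U V) ha' hb' hab
    (hlink.separatesCycles hG.disjoint ha') j]
  refine congrArg _ (Finset.sum_congr rfl fun i hi => ?_)
  rw [matchingSum_deletePair ω hUV hG, matchingSum_deletePair_deleteEdges_compl ω hUV hG ha' hb'
    (Finset.ne_of_mem_erase hi), mul_assoc (_ * _)]

theorem corollary3p4 {W R : Type*} [Fintype W] [CommRing R]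
    (G : SimpleGraph W) (D : PlaneDrawing G) (ω : Sym2 W → R)
    (U V : Set W) (n : ℕ) (hUV : U ∪ V = Set.univ) (hG : G.IsBipartiteWith U V)
    (hU : U.ncard = n) (hV : V.ncard = n)
    (k : ℕ) (hk : 2 ≤ k) (hkn : k ≤ n)
    (a b : Fin k → W) (hab : ∀ i, G.Adj (a i) (b i))
    (hindep : Pairwise fun i j => Disjoint ({a i, b i} : Set W) {a j, b j})
    (f : Set ℂ) (hf : D.IsFace f)
    (hbd : ∀ i, D.EdgeOnBoundary f ⟨(a i, b i), hab i⟩)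
    (hcyc : D.InCyclicOrder f (alternating a b))
    (hA : ∀ i, a i ∈ U) (hB : ∀ i, b i ∈ V)
    (e : Fin k → Sym2 W) (he : ∀ i, e i = s(a i, b i)) (j : Fin k) :
    matchingSum ω (⊤ : G.Subgraph) *
        matchingSum ω ((⊤ : G.Subgraph).deleteEdges (Set.range e)) =
      matchingSum ω ((⊤ : G.Subgraph).deleteEdges {e j}) *
          matchingSum ω ((⊤ : G.Subgraph).deleteEdges (e '' {j}ᶜ)) +
        ∑ i ∈ Finset.univ.erase j,
          ω (e i) * ω (e j) *
            matchingSum ω ((⊤ : G.Subgraph).deleteVerts {a i, b j}) *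
            matchingSum ω
              (((⊤ : G.Subgraph).deleteVerts {a j, b i}).deleteEdges (e '' {i, j}ᶜ)) :=
  corollary3p4_general G ω U V hUV hG a b hab
    (injective_of_pairwise_disjoint hindep fun _ => Set.mem_insert _ _)
    (injective_of_pairwise_disjoint hindep fun _ => Set.mem_insert_of_mem _ rfl)
    hA hB (D.noDisjointLinkage hf hcyc) e he j
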